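/- **Conventions.** Let $X$ be a non-empty coarse space (a set with a collection of controlled subsets of $X\times X$ containing the diagonal and closed under subsets, inverses, finite unions and compositions). For $E\subseteq X\times X$ put $E_x=\{y:(y,x)\in E\}$ and $E_U=\bigcup_{x\in U}E_x$. A set $U\subseteq X$ is *bounded* if $U\times U$ is controlled; $X$ is *connected* if every $\{(x,y)\}$ is controlled. Let $\mu$ be a measure on a $\sigma$-algebra on $X$ containing all singletons. A set $E$ is *measurable* if $E_U$ is measurable for every measurable $U$. The measure $\mu$ is *uniformly bounded* if for every controlled $E$ there is $C<\infty$ with $\mu(U)\le C$ for all measurable $U$ with $U\times U\subseteq E$. A *gordo set* is a symmetric measurable controlled set $E$ with $\inf_x\mu(E_x)>0$. *Amenability.* $(X,\mu)$ is amenable if for every measurable controlled $E$ and every $\epsilon>0$ there is a non-empty bounded measurable $U\subseteq X$ with $\mu(E_U)\le(1+\epsilon)\mu(U)$. *Geometric property (T).* An operator $T\in B(L^2(X,\mu))$ is *supported on* $E$ if $\langle\xi,T\eta\rangle=\langle\xi,T(\eta|_{E_U})\rangle$ for all measurable $U$, all $\xi$ supported on $U$ and all $\eta$. Let $\mathbb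 C_{\mathrm{cs}}[X]$ be the unital $*$-algebra of the operators that are supported on some measurable controlled set. For $T\in\mathbb C_{\mathrm{cs}}[X]$ let $\Phi(T)=T(\mathbb 1_X)$ be the locally square integrable function with $\langle\xi,\Phi(T)\rangle=\langle T^*\xi,\mathbb 1_X\rangle$ for all $\xi\in L^2(X,\mu)$ with bounded support, and for $f\in L^\infty(X,\mu)$ let $M_f$ be multiplication by $f$. For a unital $*$-representation $\rho$ of $\mathbb C_{\mathrm{cs}}[X]$ on a Hilbert space $\mathcal H$, let $\mathcal H_c$ be the space of those $v$ with $\rho(T)v=\rho(M_{\Phi(T)})v$ for all $T$ with $\Phi(T)$ bounded. For a controlled set $E$ and $\epsilon>0$, an operator $T\in\mathbb C_{\mathrm{cs}}[X]$ is *in $(E,\epsilon)$-blocks* if it is supported on $\bigsqcup_iA_i\times A_i$ for some pairwise disjoint measurable sets $A_i$ with $\bigcup_iA_i\times A_i\subseteq E$ and $\mu(A_i)\ge\epsilon$ for all $i$. Then $(X,\mu)$ has geometric property (T) if there are a controlled set $E$ and constants $\epsilon,\gamma>0$ such that for every such representation $(\rho,\mathcal H)$ and every unit vector $v\in\mathcal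 H_c^\perp$ there is a non-zero operator $T$ in $(E,\epsilon)$-blocks with $\Phi(T)$ bounded and $\|\rho(T-M_{\Phi(T)})v\|\ge\gamma\|T\|$, where $\|T\|$ is the norm in $B(L^2(X,\mu))$. **Theorem.** Let $X$ be a non-empty connected coarse space that is a union of countably many bounded sets, and let $\mu$ be a uniformly bounded measure on $X$ for which a gordo set exists. If $X$ is bounded, then $(X,\mu)$ is amenable and has geometric property (T). If $X$ is unbounded, then $(X,\mu)$ has geometric property (T) if and only if it is not amenable. -/

import Mathlib

open MeasureTheory Set
open scoped ENNReal ComplexConjugate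

universe u

/-- A coarse structure on `X`: a collection of subsets of `X × X`, the controlled sets, containing
the diagonal and closed under subsets, inverses, binary unions and compositions. -/
class CoarseSpace (X : Type u) where
  IsControlled : Set (X × X) → Prop
  diagonal : IsControlled {p | p.1 = p.2}
  mono : ∀ {E F : Set (X × X)}, IsControlled E → F ⊆ E → IsControlled F
  inv : ∀ {E : Set (X × X)}, IsControlled E → IsControlled {p | (p.2, p.1) ∈ E}
  union : ∀ {E F : Set (X × X)}, IsControlled E → IsControlled F → IsControlled (E ∪ F)
  comp : ∀ {E F : Set (X × X)}, IsControlled E → IsControlled F →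
    IsControlled {p | ∃ y, (p.1, y) ∈ E ∧ (y, p.2) ∈ F}

namespace CoarseSpace

noncomputable section

variable {X : Type u}

section Sets

/-- The set `E_U`, the union over `x ∈ U` of the sets `E_x = {y | (y, x) ∈ E}`. -/
def thicken (E : Set (X × X)) (U : Set X) : Set X := {y | ∃ x ∈ U, (y, x) ∈ E}

/-- `E` equals its inverse. -/
def IsSymmetric (E : Set (X × X)) : Prop := ∀ x y, (x, y) ∈ E ↔ (y, x) ∈ E

theorem isSymmetric_diagonal : IsSymmetric {p : X × X | p.1 = p.2} := fun _ _ => eq_comm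

/-- A set `E ⊆ X × X` is measurable (as an operation on subsets of `X`) if `E_U` is measurable for
each measurable `U`. -/
def MeasurableRel [MeasurableSpace X] (E : Set (X × X)) : Prop :=
  ∀ U : Set X, MeasurableSet U → MeasurableSet (thicken E U)

/-- The set `⋃ A × A`, where `A` ranges over the collection `𝒜`. -/
def blockSet (𝒜 : Set (Set X)) : Set (X × X) := ⋃ A ∈ 𝒜, A ×ˢ A

variable [CoarseSpace X]

/-- `U` is bounded if `U × U` is controlled. -/
def Bounded (U : Set X) : Prop := IsControlled (U ×ˢ U)

variable (X) in
/-- Every one-point set `{(x, y)}` is controlled. -/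
def Connected : Prop := ∀ x y : X, IsControlled {(x, y)}

variable (X) in
/-- `X` is a union of countably many bounded sets. -/
def CountablyCovered : Prop := ∃ B : ℕ → Set X, (∀ n, Bounded (B n)) ∧ ⋃ n, B n = univ

variable [MeasurableSpace X]

/-- For each controlled `E`, the measures of the `E`-bounded measurable sets are bounded by a
finite constant. -/
def UniformlyBounded (μ : Measure X) : Prop :=
  ∀ E : Set (X × X), IsControlled E →
    ∃ C : NNReal, ∀ U : Set X, MeasurableSet U → U ×ˢ U ⊆ E → μ U ≤ C

/-- A symmetric measurable controlled set `E` such that `μ (E_x)` is bounded away from zero. -/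
def Gordo (μ : Measure X) (E : Set (X × X)) : Prop :=
  IsControlled E ∧ IsSymmetric E ∧ MeasurableRel E ∧
    ∃ c : ℝ, 0 < c ∧ ∀ x : X, ENNReal.ofReal c ≤ μ (thicken E {x})

/-- `(E, ε)`-blocking collections of measurable sets. -/
structure IsBlocking (μ : Measure X) (E : Set (X × X)) (ε : ℝ) (𝒜 : Set (Set X)) : Prop where
  measurableSet : ∀ A ∈ 𝒜, MeasurableSet A
  subset : blockSet 𝒜 ⊆ E
  disjoint : ∀ A ∈ 𝒜, ∀ B ∈ 𝒜, A ≠ B → Disjoint A B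
  le_measure : ∀ A ∈ 𝒜, ENNReal.ofReal ε ≤ μ A

/-- Amenability, as the Følner condition. -/
def Amenable (μ : Measure X) : Prop :=
  ∀ E : Set (X × X), IsControlled E → MeasurableRel E → ∀ ε : ℝ, 0 < ε →
    ∃ U : Set X, U.Nonempty ∧ Bounded U ∧ MeasurableSet U ∧
      μ (thicken E U) ≤ ENNReal.ofReal (1 + ε) * μ U

end Sets

section Support

variable [MeasurableSpace X] {μ : Measure X}

/-- The function `ξ` vanishes almost everywhere outside of `U`. -/
def VanishesOff (ξ : Lp ℂ 2 μ) (U : Set X) : Prop := ∀ᵐ x ∂μ, x ∉ U → ξ x = 0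

/-- The operator `T` is supported on `E`: if `ξ` is supported on the measurable set `U`, then
`⟨ξ, T η⟩ = ⟨ξ, T (η|_{E_U})⟩` for all `η`. Here `ζ` stands for the restriction `η|_{E_U}`, extended
by zero. -/
def SupportedOn (E : Set (X × X)) (T : Lp ℂ 2 μ →L[ℂ] Lp ℂ 2 μ) : Prop :=
  ∀ U : Set X, MeasurableSet U → ∀ ξ η ζ : Lp ℂ 2 μ, VanishesOff ξ U →
    ζ =ᵐ[μ] (thicken E U).indicator η → inner ℂ ξ (T η) = inner ℂ ξ (T ζ)

theorem exists_indicator (s : Set X) (hs : MeasurableSet s) (η : Lp ℂ 2 μ) :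
    ∃ ζ : Lp ℂ 2 μ, ζ =ᵐ[μ] s.indicator η :=
  ⟨((Lp.memLp η).indicator hs).toLp _, MemLp.coeFn_toLp _⟩

theorem inner_eq_of_ae {ξ η ξ' η' : Lp ℂ 2 μ}
    (h : ∀ᵐ x ∂μ, inner ℂ (ξ x) (η x) = inner ℂ (ξ' x) (η' x)) : inner ℂ ξ η = inner ℂ ξ' η' := by
  rw [L2.inner_def, L2.inner_def]
  exact integral_congr_ae h

theorem vanishesOff_of_inner {U : Set X} (hU : MeasurableSet U) {η : Lp ℂ 2 μ}
    (h : ∀ ζ : Lp ℂ 2 μ, ζ =ᵐ[μ] Uᶜ.indicator η → inner ℂ ζ η = 0) : VanishesOff η U := by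
  obtain ⟨ζ, hζ⟩ := exists_indicator Uᶜ hU.compl η
  have h0 : inner ℂ ζ ζ = 0 := by
    rw [← h ζ hζ]
    apply inner_eq_of_ae
    filter_upwards [hζ] with x hx
    by_cases hxU : x ∈ Uᶜ <;> simp [hx, hxU]
  have hz : ζ = 0 := inner_self_eq_zero.1 h0
  subst hz
  filter_upwards [hζ, Lp.coeFn_zero ℂ 2 μ] with x hx h0 hxU
  rw [h0] at hx
  simpa [hxU] using hx.symm

theorem supportedOn_iff {E : Set (X × X)} (hE : MeasurableRel E) {T : Lp ℂ 2 μ →L[ℂ] Lp ℂ 2 μ} :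
    SupportedOn E T ↔ ∀ U : Set X, MeasurableSet U → ∀ ξ : Lp ℂ 2 μ, VanishesOff ξ U →
      VanishesOff (star T ξ) (thicken E U) := by
  constructor
  · intro h U hU ξ hξ
    refine vanishesOff_of_inner (hE U hU) fun ζ hζ => ?_
    have h1 := h U hU ξ ζ 0 hξ (by
      filter_upwards [hζ, Lp.coeFn_zero ℂ 2 μ] with x hx h0
      rw [h0]
      by_cases hxU : x ∈ thicken E U <;> simp [hx, hxU])
    rw [map_zero, inner_zero_right] at h1
    rw [ContinuousLinearMap.star_eq_adjoint, ContinuousLinearMap.adjoint_inner_right,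
      ← inner_conj_symm, h1, map_zero]
  · intro h U hU ξ η ζ hξ hζ
    rw [← ContinuousLinearMap.adjoint_inner_left, ← ContinuousLinearMap.adjoint_inner_left]
    apply inner_eq_of_ae
    filter_upwards [h U hU ξ hξ, hζ] with x hx hz
    by_cases hxU : x ∈ thicken E U
    · simp [hz, hxU]
    · rw [ContinuousLinearMap.star_eq_adjoint] at hx
      simp [hx hxU]

theorem supportedOn_star {E : Set (X × X)} (hE : MeasurableRel E) (hs : IsSymmetric E)
    {T : Lp ℂ 2 μ →L[ℂ] Lp ℂ 2 μ} (hT : SupportedOn E T) : SupportedOn E (star T) := by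
  rw [supportedOn_iff hE] at hT ⊢
  intro U hU η hη
  rw [star_star]
  refine vanishesOff_of_inner (hE U hU) fun ζ hζ => ?_
  have h1 := hT _ (hE U hU).compl ζ (by
    filter_upwards [hζ] with x hx hxU
    simp [hx, hxU])
  rw [← ContinuousLinearMap.adjoint_inner_left]
  rw [ContinuousLinearMap.star_eq_adjoint] at h1
  rw [L2.inner_def]
  apply integral_eq_zero_of_ae
  filter_upwards [h1, hη] with x hx hx'
  by_cases hxU : x ∈ U
  · have : x ∉ thicken E (thicken E U)ᶜ := by
      rintro ⟨y, hy, hxy⟩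
      exact hy ⟨x, hxU, (hs _ _).1 hxy⟩
    simp [hx this]
  · simp [hx' hxU]

end Support

section Algebra

variable [MeasurableSpace X]

theorem measurableRel_union {E F : Set (X × X)} (hE : MeasurableRel E) (hF : MeasurableRel F) :
    MeasurableRel (E ∪ F) := by
  intro U hU
  have : thicken (E ∪ F) U = thicken E U ∪ thicken F U := by
    ext y
    simp only [thicken, mem_union, mem_ofPred_eq]
    grind
  rw [this]
  exact (hE U hU).union (hF U hU)

theorem measurableRel_comp {E F : Set (X × X)} (hE : MeasurableRel E) (hF : MeasurableRel F) :
    MeasurableRel {p : X × X | ∃ y, (p.1, y) ∈ E ∧ (y, p.2) ∈ F} := by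
  intro U hU
  have : thicken {p : X × X | ∃ y, (p.1, y) ∈ E ∧ (y, p.2) ∈ F} U = thicken E (thicken F U) := by
    ext y
    simp only [thicken, mem_ofPred_eq]
    grind
  rw [this]
  exact hE _ (hF U hU)

theorem measurableRel_diagonal : MeasurableRel {p : X × X | p.1 = p.2} := by
  intro U hU
  have : thicken {p : X × X | p.1 = p.2} U = U := by
    ext y
    simp [thicken]
  rwa [this]

variable {μ : Measure X}

theorem VanishesOff.mono {ξ : Lp ℂ 2 μ} {U V : Set X} (h : VanishesOff ξ U) (hUV : U ⊆ V) :
    VanishesOff ξ V := by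
  filter_upwards [h] with x hx hxV using hx fun hU => hxV (hUV hU)

theorem SupportedOn.mono {E F : Set (X × X)} (hE : MeasurableRel E) (hF : MeasurableRel F)
    (hEF : E ⊆ F) {T : Lp ℂ 2 μ →L[ℂ] Lp ℂ 2 μ} (h : SupportedOn E T) : SupportedOn F T := by
  rw [supportedOn_iff hE] at h
  rw [supportedOn_iff hF]
  exact fun U hU ξ hξ => (h U hU ξ hξ).mono fun y ⟨x, hx, hxy⟩ => ⟨x, hx, hEF hxy⟩

theorem SupportedOn.add {E : Set (X × X)} (hE : MeasurableRel E)
    {T S : Lp ℂ 2 μ →L[ℂ] Lp ℂ 2 μ} (hT : SupportedOn E T) (hS : SupportedOn E S) :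
    SupportedOn E (T + S) := by
  rw [supportedOn_iff hE] at *
  intro U hU ξ hξ
  rw [star_add, add_apply]
  filter_upwards [hT U hU ξ hξ, hS U hU ξ hξ, Lp.coeFn_add (star T ξ) (star S ξ)] with x h1 h2 h3 hx
  rw [h3, Pi.add_apply, h1 hx, h2 hx, add_zero]

theorem SupportedOn.mul {E F : Set (X × X)} (hE : MeasurableRel E) (hF : MeasurableRel F)
    {T S : Lp ℂ 2 μ →L[ℂ] Lp ℂ 2 μ} (hT : SupportedOn E T) (hS : SupportedOn F S) :
    SupportedOn {p | ∃ y, (p.1, y) ∈ F ∧ (y, p.2) ∈ E} (T * S) := by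
  rw [supportedOn_iff hE] at hT
  rw [supportedOn_iff hF] at hS
  rw [supportedOn_iff (measurableRel_comp hF hE)]
  intro U hU ξ hξ
  rw [star_mul, mul_apply_eq_comp]
  refine (hS _ (hE U hU) _ (hT U hU ξ hξ)).mono ?_
  rintro y ⟨z, ⟨x, hx, hzx⟩, hyz⟩
  exact ⟨x, hx, z, hyz, hzx⟩

/-- The multiplication operator `M_f` on `L²` of a function `f` in `L^∞`. -/
def mulOp (f : Lp ℂ ∞ μ) : Lp ℂ 2 μ →L[ℂ] Lp ℂ 2 μ :=
  (ContinuousLinearMap.mul ℂ ℂ).holderL μ ∞ 2 2 f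

theorem coeFn_mulOp (f : Lp ℂ ∞ μ) (η : Lp ℂ 2 μ) : mulOp f η =ᵐ[μ] fun x => f x * η x :=
  ContinuousLinearMap.coeFn_holder (ContinuousLinearMap.mul ℂ ℂ) f η

theorem supportedOn_mulOp (f : Lp ℂ ∞ μ) : SupportedOn {p : X × X | p.1 = p.2} (mulOp f) := by
  intro U hU ξ η ζ hξ hζ
  apply inner_eq_of_ae
  filter_upwards [hξ, hζ, coeFn_mulOp f η, coeFn_mulOp f ζ] with x h1 h2 h3 h4
  by_cases hxU : x ∈ U
  · have : x ∈ thicken {p : X × X | p.1 = p.2} U := ⟨x, hxU, rfl⟩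
    simp [h2, h3, h4, this]
  · simp [h1 hxU]

theorem supportedOn_algebraMap (c : ℂ) :
    SupportedOn {p : X × X | p.1 = p.2}
      (algebraMap ℂ (Lp ℂ 2 μ →L[ℂ] Lp ℂ 2 μ) c) := by
  rw [supportedOn_iff measurableRel_diagonal]
  intro U hU ξ hξ
  have : star (algebraMap ℂ (Lp ℂ 2 μ →L[ℂ] Lp ℂ 2 μ) c) ξ = (star c) • ξ := by
    rw [← algebraMap_star_comm, Algebra.algebraMap_eq_smul_one]
    simp
  rw [this]
  filter_upwards [hξ, Lp.coeFn_smul (star c) ξ] with x h1 h2 hx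
  have hxU : x ∉ U := fun h => hx ⟨x, h, rfl⟩
  rw [h2, Pi.smul_apply, h1 hxU, smul_zero]

variable [CoarseSpace X]

/-- `T` is supported on some measurable controlled set. The set is asked to be symmetric; by
`hasControlledSupport_iff` below this makes no difference on the spaces under consideration. -/
def HasControlledSupport (T : Lp ℂ 2 μ →L[ℂ] Lp ℂ 2 μ) : Prop :=
  ∃ E : Set (X × X), IsControlled E ∧ IsSymmetric E ∧ MeasurableRel E ∧ SupportedOn E T

variable (μ) in
/-- The unital `*`-algebra `ℂ_cs[X]` of operators on `L²(X, μ)` with controlled support. -/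
def controlledAlgebra : StarSubalgebra ℂ (Lp ℂ 2 μ →L[ℂ] Lp ℂ 2 μ) where
  carrier := {T | HasControlledSupport T}
  mul_mem' := by
    rintro T S ⟨E, hE, hEs, hEm, hT⟩ ⟨F, hF, hFs, hFm, hS⟩
    refine ⟨_, union (comp hF hE) (comp hE hF), fun x y => ?_,
      measurableRel_union (measurableRel_comp hFm hEm) (measurableRel_comp hEm hFm),
      (hT.mul hEm hFm hS).mono (measurableRel_comp hFm hEm)
        (measurableRel_union (measurableRel_comp hFm hEm) (measurableRel_comp hEm hFm))
        subset_union_left⟩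
    simp only [IsSymmetric] at hEs hFs
    simp only [mem_union, mem_ofPred_eq]
    grind
  add_mem' := by
    rintro T S ⟨E, hE, hEs, hEm, hT⟩ ⟨F, hF, hFs, hFm, hS⟩
    have hm := measurableRel_union hEm hFm
    refine ⟨_, union hE hF, fun x y => ?_, hm,
      (hT.mono hEm hm subset_union_left).add hm (hS.mono hFm hm subset_union_right)⟩
    rw [mem_union, mem_union, hEs x y, hFs x y]
  algebraMap_mem' c := ⟨_, diagonal, isSymmetric_diagonal, measurableRel_diagonal,
    supportedOn_algebraMap c⟩
  star_mem' := by
    rintro T ⟨E, hE, hEs, hEm, hT⟩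
    exact ⟨E, hE, hEs, hEm, supportedOn_star hEm hEs hT⟩

/-- The multiplication operator `M_f` as an element of `ℂ_cs[X]`. -/
def mulElem (f : Lp ℂ ∞ μ) : controlledAlgebra μ :=
  ⟨mulOp f, _, diagonal, isSymmetric_diagonal, measurableRel_diagonal, supportedOn_mulOp f⟩

/-- The (equivalence class of the) bounded function `f` is `Φ(T) = T(𝟙_X)`, where `T` acts on
locally square integrable functions as the dual of the restriction of `T*` to the `L²`-functions
with bounded support: `⟨ξ, Φ(T)⟩ = ⟨T* ξ, 𝟙_X⟩` for all such `ξ`. Thus `Φ(T)` is bounded if and only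
if there is an `f` with `IsPhi T f`, and this `f` is then unique. -/
def IsPhi (T : controlledAlgebra μ) (f : Lp ℂ ∞ μ) : Prop :=
  ∀ (U : Set X) (ξ : Lp ℂ 2 μ), Bounded U → MeasurableSet U → VanishesOff ξ U →
    ∫ x, conj (ξ x) * f x ∂μ = ∫ x, conj ((star T : controlledAlgebra μ).1 ξ x) ∂μ

/-- `T` is an operator in `(E, ε)`-blocks. -/
def InBlocks (E : Set (X × X)) (ε : ℝ) (T : controlledAlgebra μ) : Prop :=
  ∃ 𝒜 : Set (Set X), IsBlocking μ E ε 𝒜 ∧ SupportedOn (blockSet 𝒜) T.1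

section Representation

variable {H : Type u} [NormedAddCommGroup H] [InnerProductSpace ℂ H] [CompleteSpace H]

/-- The subspace `H_c` of constant vectors of a representation `ρ` of `ℂ_cs[X]` on `H`. -/
def constantVectors (ρ : controlledAlgebra μ →⋆ₐ[ℂ] (H →L[ℂ] H)) : Submodule ℂ H where
  carrier := {v | ∀ (T : controlledAlgebra μ) (f : Lp ℂ ∞ μ), IsPhi T f →
    ρ T v = ρ (mulElem f) v}
  zero_mem' := by simp
  add_mem' := by
    intro v w hv hw T f h
    rw [map_add, map_add, hv T f h, hw T f h]
  smul_mem' := by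
    intro c v hv T f h
    rw [map_smul, map_smul, hv T f h]

end Representation

variable (μ) in
/-- Geometric property (T). The operator `T` has to be nonzero, since `T = 0` satisfies the
inequality for trivial reasons. Every cyclic representation of `ℂ_cs[X]` is isomorphic to one on a
Hilbert space in the universe of `X`. -/
def GeometricPropertyT : Prop :=
  ∃ (E : Set (X × X)) (ε γ : ℝ), IsControlled E ∧ 0 < ε ∧ 0 < γ ∧
    ∀ (H : Type u) [NormedAddCommGroup H] [InnerProductSpace ℂ H] [CompleteSpace H]
      (ρ : controlledAlgebra μ →⋆ₐ[ℂ] (H →L[ℂ] H)) (v : H),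
      v ∈ (constantVectors ρ)ᗮ → ‖v‖ = 1 →
        ∃ (T : controlledAlgebra μ) (f : Lp ℂ ∞ μ), T ≠ 0 ∧ InBlocks E ε T ∧ IsPhi T f ∧
          γ * ‖T.1‖ ≤ ‖ρ (T - mulElem f) v‖

end Algebra

section Comparison

variable [MeasurableSpace X] [CoarseSpace X]

/-- A bounded set has only finitely many points `i` for which the sets `F_i` are disjoint. -/
theorem finite_of_gordo {μ : Measure X} (hb : UniformlyBounded μ) {F : Set (X × X)}
    [MeasurableSingletonClass X] (hF : Gordo μ F) {B I : Set X} (hB : Bounded B) (hIB : I ⊆ B)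
    (hI : I.PairwiseDisjoint fun i => thicken F {i}) : I.Finite := by
  obtain ⟨hFc, hFs, hFm, c, hc, hcF⟩ := hF
  obtain ⟨C, hC⟩ := hb _ (comp (comp hFc hB) hFc)
  by_contra hinf
  obtain ⟨n, hn⟩ := exists_nat_gt ((C : ℝ) / c)
  obtain ⟨J, hJI, hJ⟩ := Set.Infinite.exists_subset_card_eq hinf n
  have hmeas : ∀ i ∈ J, MeasurableSet (thicken F {i}) := fun i _ => hFm _ (measurableSet_singleton i)
  have h1 : μ (⋃ i ∈ J, thicken F {i}) = ∑ i ∈ J, μ (thicken F {i}) :=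
    measure_biUnion_finset (hI.subset hJI) hmeas
  have h2 : μ (⋃ i ∈ J, thicken F {i}) ≤ C := by
    apply hC _ (Finset.measurableSet_biUnion J hmeas)
    rintro ⟨x, y⟩ ⟨hx, hy⟩
    simp only [mem_iUnion] at hx hy
    obtain ⟨i, hi, a, rfl, hx⟩ := hx
    obtain ⟨j, hj, b, rfl, hy⟩ := hy
    exact ⟨b, ⟨a, hx, hIB (hJI hi), hIB (hJI hj)⟩, (hFs _ _).1 hy⟩
  have h3 : (n : ℝ≥0∞) * ENNReal.ofReal c ≤ C := by
    refine le_trans ?_ (h1 ▸ h2)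
    rw [← hJ, ← nsmul_eq_mul]
    exact Finset.card_nsmul_le_sum _ _ _ fun i _ => hcF i
  have h4 : (n : ℝ) * c ≤ C := by
    have := ENNReal.toReal_mono ENNReal.coe_ne_top h3
    simpa [ENNReal.toReal_mul, ENNReal.toReal_ofReal hc.le] using this
  rw [div_lt_iff₀ hc] at hn
  linarith

/-- A controlled set is contained in a symmetric measurable controlled set. -/
theorem exists_symmetric_measurable_superset [MeasurableSingletonClass X] {μ : Measure X}
    (hc : CountablyCovered X) (hb : UniformlyBounded μ) (hg : ∃ F, Gordo μ F) {E : Set (X × X)}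
    (hE : IsControlled E) :
    ∃ E', E ⊆ E' ∧ IsControlled E' ∧ IsSymmetric E' ∧ MeasurableRel E' := by
  obtain ⟨F, hF⟩ := hg
  obtain ⟨B, hB, hBu⟩ := hc
  obtain ⟨I, hI⟩ := zorn_subset {I : Set X | I.PairwiseDisjoint fun i => thicken F {i}} (by
    intro c hcs hcc
    refine ⟨⋃₀ c, ?_, fun s hs => subset_sUnion_of_mem hs⟩
    exact (pairwiseDisjoint_sUnion hcc.directedOn).2 fun s hs => hcs hs)
  have hId : I.PairwiseDisjoint fun i => thicken F {i} := hI.prop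
  have hIc : I.Countable := by
    have : I = ⋃ n, I ∩ B n := by rw [← inter_iUnion, hBu, inter_univ]
    rw [this]
    exact countable_iUnion fun n =>
      (finite_of_gordo hb hF (hB n) inter_subset_right (hId.subset inter_subset_left)).countable
  obtain ⟨hFc, hFs, hFm, c, hc, hcF⟩ := hF
  have hne : ∀ x, (thicken F {x}).Nonempty := by
    intro x
    apply nonempty_of_measure_ne_zero (μ := μ)
    exact (lt_of_lt_of_le (ENNReal.ofReal_pos.2 hc) (hcF x)).ne'
  -- the sets `G i` cover the space
  let G : X → Set X := fun i => thicken F (thicken F {i})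
  have hG : ∀ x, ∃ i ∈ I, x ∈ G i := by
    intro x
    have key : ∃ i ∈ I, ¬ Disjoint (thicken F {x}) (thicken F {i}) := by
      by_contra hcon
      push Not at hcon
      have hins : (insert x I).PairwiseDisjoint fun i => thicken F {i} :=
        hId.insert fun j hj _ => hcon j hj
      have hxI : x ∈ I := hI.le_of_ge hins (subset_insert x I) (mem_insert x I)
      exact (hne x).ne_empty (disjoint_self.1 (hcon x hxI))
    obtain ⟨i, hi, hd⟩ := key
    obtain ⟨y, ⟨a, rfl, hy⟩, hy'⟩ := not_disjoint_iff.1 hd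
    exact ⟨i, hi, y, hy', (hFs _ _).1 hy⟩
  have hGm : ∀ i, MeasurableSet (G i) := fun i => hFm _ (hFm _ (measurableSet_singleton i))
  let D : Set (X × X) := {p | ∃ i, p.1 ∈ G i ∧ p.2 ∈ G i}
  have hD : IsControlled D := by
    refine mono (comp (comp hFc hFc) (comp hFc hFc)) ?_
    rintro ⟨x, y⟩ ⟨i, ⟨a, ⟨b, rfl, hab⟩, hxa⟩, ⟨a', ⟨b', rfl, hab'⟩, hya⟩⟩
    exact ⟨b', ⟨a, hxa, hab⟩, ⟨a', (hFs _ _).1 hab', (hFs _ _).1 hya⟩⟩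
  let S : X → X → Prop := fun i j => i ∈ I ∧ j ∈ I ∧
    ∃ x y, x ∈ G i ∧ y ∈ G j ∧ ((x, y) ∈ E ∨ (y, x) ∈ E)
  have hS : ∀ i j, S i j → S j i := by
    rintro i j ⟨hi, hj, x, y, hx, hy, h⟩
    exact ⟨hj, hi, y, x, hy, hx, h.symm⟩
  refine ⟨{p | ∃ i j, S i j ∧ p.1 ∈ G i ∧ p.2 ∈ G j}, ?_, ?_, ?_, ?_⟩
  · rintro ⟨x, y⟩ hxy
    obtain ⟨i, hi, hx⟩ := hG x
    obtain ⟨j, hj, hy⟩ := hG y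
    exact ⟨i, j, ⟨hi, hj, x, y, hx, hy, Or.inl hxy⟩, hx, hy⟩
  · refine mono (comp (comp hD (union hE (inv hE))) hD) ?_
    rintro ⟨x, y⟩ ⟨i, j, ⟨hi, hj, a, b, ha, hb, h⟩, hx, hy⟩
    exact ⟨b, ⟨a, ⟨i, hx, ha⟩, h⟩, j, hb, hy⟩
  · intro x y
    exact ⟨fun ⟨i, j, h, hx, hy⟩ => ⟨j, i, hS _ _ h, hy, hx⟩,
      fun ⟨i, j, h, hx, hy⟩ => ⟨j, i, hS _ _ h, hy, hx⟩⟩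
  · intro U hU
    have : thicken {p : X × X | ∃ i j, S i j ∧ p.1 ∈ G i ∧ p.2 ∈ G j} U =
        ⋃ i ∈ {i | i ∈ I ∧ ∃ j, S i j ∧ (G j ∩ U).Nonempty}, G i := by
      ext y
      simp only [mem_iUnion]
      constructor
      · rintro ⟨x, hx, i, j, h, hy, hxj⟩
        exact ⟨i, ⟨h.1, j, h, x, hxj, hx⟩, hy⟩
      · rintro ⟨i, ⟨hi, j, h, x, hxj, hx⟩, hy⟩
        exact ⟨x, hx, i, j, h, hy, hxj⟩
    rw [this]
    exact MeasurableSet.biUnion (hIc.mono fun i hi => hi.1) fun i _ => hGm i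

theorem hasControlledSupport_iff [MeasurableSingletonClass X] {μ : Measure X}
    (hc : CountablyCovered X) (hb : UniformlyBounded μ) (hg : ∃ F, Gordo μ F) (T : Lp ℂ 2 μ →L[ℂ] Lp ℂ 2 μ) :
    HasControlledSupport T ↔
      ∃ E : Set (X × X), IsControlled E ∧ MeasurableRel E ∧ SupportedOn E T := by
  constructor
  · rintro ⟨E, h1, -, h2, h3⟩
    exact ⟨E, h1, h2, h3⟩
  · rintro ⟨E, h1, h2, h3⟩
    obtain ⟨E', h, h4, h5, h6⟩ := exists_symmetric_measurable_superset hc hb hg h1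
    exact ⟨E', h4, h5, h6, h3.mono h2 h6 h⟩

end Comparison

end

end CoarseSpace

/-! The main tool is the averaging projection `P` over a countable disjoint family of blocks of
finite positive measure (`blockProj`). It has norm at most `1`, and `Φ(P)` is the indicator of the
union of the blocks (`isPhi_blockElem`).

If `X` is bounded, then `X` itself is a Følner set, and `P` may average over the single block `X`.
Since `T P = M_{Φ(T)} P` for every `T` with bounded `Φ(T)`, the vector `ρ(P)v` is constant. It
therefore vanishes when `v` is orthogonal to the constant vectors, and `‖ρ(P - 1)v‖ = ‖v‖`.

For the other two cases, `X` is cut into countably many uniformly bounded cells with measures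
between constants `c > 0` and `C` (`exists_cells`).

If `X` is not amenable, iterated expansion and Hall's marriage theorem give, for each `K`,
injections `g(·, k)`, `k < K`, of the set of cells into itself with disjoint ranges, each moving
cells by a controlled amount (`exists_injective_nbhd`). Let `v` be a unit vector on which every
operator in blocks nearly agrees with its `M_Φ`. The compression `P M_h P` depends only on the block
integrals of `h`. So averaging over pairs `{j, f j}` bounds the mass of `v` on a set `J` of cells by
a constant times its mass on `f(J)`, up to a small error, if `f(J)` misses `J`
(`mass_le_of_almost_constant`). A 3-colouring reduces a general `f` to this case. Each of the `K`
disjoint ranges thus carries mass bounded below independently of `K`, which is impossible for large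
`K`.

If `X` is amenable and unbounded, the identity representation on `L²` has no non-zero constant
vectors (`eq_zero_of_mem_constantVectors`). Yet the normalised indicator `w` of a Følner set `W` is
almost constant: for `T` in blocks, `Tw - M_{Φ(T)}w` lives on the blocks that cross the boundary of
`W`, and its norm is controlled by their measure (`norm_sub_mulOp_le`). This contradicts property
(T). -/

namespace CoarseSpace

/-! ### Bounded sets and block relations. -/

section BoundedSets

variable {X : Type u}

theorem thicken_comp (E F : Set (X × X)) (U : Set X) :
    thicken {p : X × X | ∃ y, (p.1, y) ∈ E ∧ (y, p.2) ∈ F} U = thicken E (thicken F U) := by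
  ext y
  simp only [thicken, mem_ofPred_eq]
  grind

theorem mem_blockSet_range {κ : Type*} {B : κ → Set X} {x y : X} :
    (x, y) ∈ blockSet (range B) ↔ ∃ k, x ∈ B k ∧ y ∈ B k := by
  simp [blockSet]

theorem thicken_blockSet (𝒜 : Set (Set X)) (U : Set X) :
    thicken (blockSet 𝒜) U = ⋃ A ∈ {A ∈ 𝒜 | (A ∩ U).Nonempty}, A := by
  ext y
  simp only [thicken, blockSet, mem_iUnion, mem_prod, mem_ofPred_eq, exists_prop]
  constructor
  · rintro ⟨x, hx, A, hA, hy, hxA⟩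
    exact ⟨A, ⟨hA, x, hxA, hx⟩, hy⟩
  · rintro ⟨A, ⟨hA, x, hxA, hx⟩, hy⟩
    exact ⟨x, hx, A, hA, hy, hxA⟩

theorem isSymmetric_blockSet (𝒜 : Set (Set X)) : IsSymmetric (blockSet 𝒜) := by
  intro x y
  simp only [blockSet, mem_iUnion, mem_prod]
  grind

theorem measurableRel_blockSet [MeasurableSpace X] {𝒜 : Set (Set X)} (hc : 𝒜.Countable)
    (hm : ∀ A ∈ 𝒜, MeasurableSet A) : MeasurableRel (blockSet 𝒜) := by
  intro U _
  rw [thicken_blockSet]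
  exact MeasurableSet.biUnion (hc.mono fun A hA => hA.1) fun A hA => hm A hA.1

variable [CoarseSpace X]

theorem Bounded.mono {U V : Set X} (hV : Bounded V) (h : U ⊆ V) : Bounded U :=
  CoarseSpace.mono hV (prod_mono h h)

theorem Bounded.thicken {U : Set X} (hU : Bounded U) {E : Set (X × X)} (hE : IsControlled E) :
    Bounded (thicken E U) := by
  refine CoarseSpace.mono (comp (comp hE hU) (inv hE)) ?_
  rintro ⟨x, y⟩ ⟨⟨a, ha, hxa⟩, ⟨b, hb, hyb⟩⟩
  exact ⟨b, ⟨a, hxa, ha, hb⟩, hyb⟩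

/-- A single controlled pair `(u, v)`, supplied by connectedness, bridges the two sets. -/
theorem Bounded.union (hconn : Connected X) {U V : Set X} (hU : Bounded U) (hV : Bounded V) :
    Bounded (U ∪ V) := by
  rcases U.eq_empty_or_nonempty with rfl | ⟨u, hu⟩
  · simpa using hV
  rcases V.eq_empty_or_nonempty with rfl | ⟨v, hv⟩
  · simpa using hU
  have hUV := comp (comp hU (hconn u v)) hV
  refine CoarseSpace.mono (CoarseSpace.union (CoarseSpace.union hU hV)
    (CoarseSpace.union hUV (inv hUV))) ?_
  have key : ∀ x ∈ U, ∀ y ∈ V, ∃ z, (∃ w, (x, w) ∈ U ×ˢ U ∧ (w, z) ∈ ({(u, v)} : Set (X × X))) ∧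
      (z, y) ∈ V ×ˢ V := fun x hx y hy => ⟨v, ⟨u, ⟨hx, hu⟩, rfl⟩, hv, hy⟩
  rintro ⟨x, y⟩ ⟨hx | hx, hy | hy⟩
  · exact Or.inl (Or.inl ⟨hx, hy⟩)
  · exact Or.inr (Or.inl (key x hx y hy))
  · exact Or.inr (Or.inr (key y hy x hx))
  · exact Or.inl (Or.inr ⟨hx, hy⟩)

theorem bounded_empty : Bounded (∅ : Set X) :=
  CoarseSpace.mono diagonal (by simp)

theorem bounded_biUnion_finset (hconn : Connected X) {ι : Type*} (s : Finset ι) (U : ι → Set X)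
    (hU : ∀ i ∈ s, Bounded (U i)) : Bounded (⋃ i ∈ s, U i) := by
  classical
  induction s using Finset.induction_on with
  | empty => simpa using bounded_empty
  | insert a s _ ih =>
    rw [Finset.set_biUnion_insert]
    exact (hU a (by simp)).union hconn (ih fun i hi => hU i (by simp [hi]))

variable [MeasurableSpace X] {μ : Measure X}

theorem UniformlyBounded.measure_ne_top (hμ : UniformlyBounded μ) {U : Set X} (hU : Bounded U)
    (hm : MeasurableSet U) : μ U ≠ ⊤ := by
  obtain ⟨C, hC⟩ := hμ _ hU
  exact ne_top_of_le_ne_top ENNReal.coe_ne_top (hC U hm le_rfl)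

end BoundedSets

/-! ### Multiplication operators by bounded measurable real functions. -/

section Multiplication

variable {X : Type u} [MeasurableSpace X] {μ : Measure X}

/-- A bounded measurable real function. -/
structure BddMeasurable (h : X → ℝ) : Prop where
  measurable : Measurable h
  bounded : ∃ C, ∀ x, |h x| ≤ C

theorem BddMeasurable.memLp {h : X → ℝ} (hh : BddMeasurable h) :
    MemLp (fun x => (h x : ℂ)) ∞ μ := by
  obtain ⟨C, hC⟩ := hh.bounded
  refine memLp_top_of_bound (Complex.measurable_ofReal.comp hh.measurable).aestronglyMeasurable C ?_
  exact Filter.Eventually.of_forall fun x => by simpa using hC x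

theorem BddMeasurable.mul {g h : X → ℝ} (hg : BddMeasurable g) (hh : BddMeasurable h) :
    BddMeasurable (g * h) := by
  obtain ⟨C, hC⟩ := hg.bounded
  obtain ⟨D, hD⟩ := hh.bounded
  refine ⟨hg.measurable.mul hh.measurable, C * D, fun x => ?_⟩
  rw [Pi.mul_apply, abs_mul]
  exact mul_le_mul (hC x) (hD x) (abs_nonneg _) ((abs_nonneg _).trans (hC x))

theorem BddMeasurable.add {g h : X → ℝ} (hg : BddMeasurable g) (hh : BddMeasurable h) :
    BddMeasurable (g + h) := by
  obtain ⟨C, hC⟩ := hg.bounded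
  obtain ⟨D, hD⟩ := hh.bounded
  exact ⟨hg.measurable.add hh.measurable, C + D, fun x =>
    (abs_add_le _ _).trans (add_le_add (hC x) (hD x))⟩

theorem bddMeasurable_const (c : ℝ) : BddMeasurable (fun _ : X => c) :=
  ⟨measurable_const, |c|, fun _ => le_rfl⟩

theorem bddMeasurable_indicator {s : Set X} (hs : MeasurableSet s) :
    BddMeasurable (s.indicator (1 : X → ℝ)) := by
  refine ⟨measurable_one.indicator hs, 1, fun x => ?_⟩
  by_cases hx : x ∈ s <;> simp [hx]

open Classical in
variable (μ) in
/-- The class of the function `h` in `L^∞` (zero if `h` is not essentially bounded). -/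
noncomputable def linf (h : X → ℝ) : Lp ℂ ∞ μ :=
  if hh : MemLp (fun x => (h x : ℂ)) ∞ μ then hh.toLp _ else 0

theorem coeFn_linf {h : X → ℝ} (hh : BddMeasurable h) : linf μ h =ᵐ[μ] fun x => (h x : ℂ) := by
  rw [linf, dif_pos hh.memLp]
  exact MemLp.coeFn_toLp _

theorem coeFn_mulOp_linf {h : X → ℝ} (hh : BddMeasurable h) (η : Lp ℂ 2 μ) :
    mulOp (linf μ h) η =ᵐ[μ] fun x => (h x : ℂ) * η x := by
  filter_upwards [coeFn_mulOp (linf μ h) η, coeFn_linf (μ := μ) hh] with x h1 h2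
  rw [h1, h2]

variable [CoarseSpace X]

variable (μ) in
/-- Multiplication by the bounded measurable real function `h`, as an element of `ℂ_cs[X]`. -/
noncomputable def mulFn (h : X → ℝ) : controlledAlgebra μ := mulElem (linf μ h)

theorem coeFn_mulFn {h : X → ℝ} (hh : BddMeasurable h) (η : Lp ℂ 2 μ) :
    (mulFn μ h).1 η =ᵐ[μ] fun x => (h x : ℂ) * η x := coeFn_mulOp_linf hh η

theorem controlledAlgebra_ext {S T : controlledAlgebra μ} (h : ∀ η, S.1 η =ᵐ[μ] T.1 η) : S = T :=
  Subtype.ext (ContinuousLinearMap.ext fun η => Lp.ext (h η))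

theorem mulFn_mul {g h : X → ℝ} (hg : BddMeasurable g) (hh : BddMeasurable h) :
    mulFn μ g * mulFn μ h = mulFn μ (g * h) := by
  refine controlledAlgebra_ext fun η => ?_
  filter_upwards [coeFn_mulFn hg ((mulFn μ h).1 η), coeFn_mulFn hh η,
    coeFn_mulFn (hg.mul hh) η] with x h1 h2 h3
  rw [h3]
  refine h1.trans ?_
  rw [h2, Pi.mul_apply]
  push_cast
  ring

theorem mulFn_add {g h : X → ℝ} (hg : BddMeasurable g) (hh : BddMeasurable h) :
    mulFn μ g + mulFn μ h = mulFn μ (g + h) := by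
  refine controlledAlgebra_ext fun η => ?_
  filter_upwards [Lp.coeFn_add ((mulFn μ g).1 η) ((mulFn μ h).1 η), coeFn_mulFn hg η,
    coeFn_mulFn hh η, coeFn_mulFn (hg.add hh) η] with x h0 h1 h2 h3
  rw [h3]
  refine h0.trans ?_
  rw [Pi.add_apply, h1, h2, Pi.add_apply]
  push_cast
  ring

theorem mulFn_const (c : ℝ) : mulFn μ (fun _ => c) = (c : ℂ) • 1 := by
  refine controlledAlgebra_ext fun η => ?_
  filter_upwards [coeFn_mulFn (bddMeasurable_const c) η, Lp.coeFn_smul (c : ℂ) η] with x h1 h2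
  rw [h1]
  exact h2.symm

theorem star_mulFn {h : X → ℝ} (hh : BddMeasurable h) : star (mulFn μ h) = mulFn μ h := by
  apply Subtype.ext
  refine ContinuousLinearMap.ext fun η => ext_inner_left ℂ fun ξ => ?_
  change inner ℂ ξ (star (mulFn μ h).1 η) = _
  rw [ContinuousLinearMap.star_eq_adjoint, ContinuousLinearMap.adjoint_inner_right]
  apply inner_eq_of_ae
  filter_upwards [coeFn_mulFn hh η, coeFn_mulFn hh ξ] with x h1 h2
  rw [h1, h2]
  simp only [RCLike.inner_apply, map_mul, Complex.conj_ofReal]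
  ring

end Multiplication

/-! ### Norm estimates in representations of a `*`-algebra. -/

section StarRepresentations

variable {A : Type*} [Ring A] [StarRing A] [Algebra ℂ A]
  {H : Type*} [NormedAddCommGroup H] [InnerProductSpace ℂ H] [CompleteSpace H]
  (ρ : A →⋆ₐ[ℂ] (H →L[ℂ] H))

theorem representation_mul (S T : A) (v : H) : ρ (S * T) v = ρ S (ρ T v) := by
  rw [map_mul, mul_apply_eq_comp]

theorem representation_add (S T : A) (v : H) : ρ (S + T) v = ρ S v + ρ T v := by
  rw [map_add, add_apply]

theorem representation_sub (S T : A) (v : H) : ρ (S - T) v = ρ S v - ρ T v := by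
  rw [map_sub, sub_apply]

theorem representation_one (v : H) : ρ 1 v = v := by
  rw [map_one, one_apply_eq_self]

theorem representation_smul_one (c : ℂ) (v : H) : ρ (c • 1) v = c • v := by
  rw [map_smul, map_one, smul_apply, one_apply_eq_self]

theorem norm_sq_representation (T : A) (v : H) :
    ‖ρ T v‖ ^ 2 = RCLike.re (inner ℂ v (ρ (star T * T) v)) := by
  rw [map_mul, map_star, mul_apply_eq_comp, ContinuousLinearMap.star_eq_adjoint,
    ContinuousLinearMap.adjoint_inner_right, inner_self_eq_norm_sq]

/-- Both squared norms are values at `v` of the quadratic form of the common compression, since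
`‖ρ(xp)v‖² = ⟨v, ρ(p x² p)v⟩` for self-adjoint `x` and `p`. -/
theorem norm_eq_of_compression_eq {p a q : A} (hp : star p = p) (ha : star a = a)
    (hq : star q = q) (h : p * (a * a) * p = p * (q * q) * p) (v : H) :
    ‖ρ a (ρ p v)‖ = ‖ρ q (ρ p v)‖ := by
  rw [← sq_eq_sq₀ (norm_nonneg _) (norm_nonneg _), ← representation_mul, ← representation_mul,
    norm_sq_representation, norm_sq_representation]
  have key : ∀ x : A, star x = x → star (x * p) * (x * p) = p * (x * x) * p := by
    intro x hx
    rw [star_mul, hp, hx]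
    simp only [mul_assoc]
  rw [key a ha, key q hq, h]

/-- As `a = a s`, the difference is `ρ(a)` applied to `ρ(p - s)v`. -/
theorem norm_sub_le_of_mul_eq {p s a : A} (has : a * s = a) (ha : ∀ w, ‖ρ a w‖ ≤ ‖w‖) {v : H}
    {γ : ℝ} (hγ : ‖ρ (p - s) v‖ ≤ γ) : ‖ρ a (ρ p v) - ρ a v‖ ≤ γ := by
  have h1 : ρ a v = ρ a (ρ s v) := by rw [← representation_mul, has]
  rw [h1, ← map_sub, ← representation_sub]
  exact (ha _).trans hγ

/-- In the application `p` averages over blocks, `s = M_{Φ(p)}`, `a` and `b` are indicators of two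
parts of the blocks, and `q` is a weight on the part `b` that imitates `a` under compression by `p`.
Since `v` is almost fixed by `p` on the blocks, the size of `v` on `a` is controlled by its size on
`b`. -/
theorem norm_sq_le_of_compression {p s a b q : A} (hp : star p = p) (ha : star a = a)
    (hq : star q = q) (h : p * (a * a) * p = p * (q * q) * p) (hqb : q * b = q)
    (has : a * s = a) (hbs : b * s = b) (ha1 : ∀ w, ‖ρ a w‖ ≤ ‖w‖) (hb1 : ∀ w, ‖ρ b w‖ ≤ ‖w‖)
    {L : ℝ} (hL1 : 1 ≤ L) (hqL : ∀ w, ‖ρ q w‖ ≤ L * ‖w‖) {v : H} {γ : ℝ}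
    (hγ : ‖ρ (p - s) v‖ ≤ γ) :
    ‖ρ a v‖ ^ 2 ≤ 2 * L ^ 2 * ‖ρ b v‖ ^ 2 + 8 * L ^ 2 * γ ^ 2 := by
  have h0 : ‖ρ a (ρ p v)‖ ≤ L * ‖ρ b (ρ p v)‖ := by
    rw [norm_eq_of_compression_eq ρ hp ha hq h v, ← hqb, representation_mul]
    exact hqL _
  have h1 := norm_sub_le_of_mul_eq ρ has ha1 hγ
  have h2 := norm_sub_le_of_mul_eq ρ hbs hb1 hγ
  have hγ0 : 0 ≤ γ := (norm_nonneg _).trans hγ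
  rw [norm_sub_rev] at h1
  have h3 := (norm_sub_norm_le _ _).trans h1
  have h4 := (norm_sub_norm_le _ _).trans h2
  have hnn : 0 ≤ ‖ρ a v‖ := norm_nonneg _
  generalize ‖ρ a (ρ p v)‖ = x' at *
  generalize ‖ρ b (ρ p v)‖ = y' at *
  generalize ‖ρ a v‖ = x at *
  generalize ‖ρ b v‖ = y at *
  have h5 : x ≤ L * y + 2 * L * γ := by
    have h6 : L * y' ≤ L * (γ + y) := by
      gcongr
      linarith
    have h7 : γ ≤ L * γ := le_mul_of_one_le_left hγ0 hL1
    linarith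
  have h6 : x ^ 2 ≤ (L * y + 2 * L * γ) ^ 2 := by gcongr
  -- This is `(s + t)² ≤ 2s² + 2t²`.
  linarith [sq_nonneg (L * y - 2 * L * γ)]

end StarRepresentations

section Representations

variable {X : Type u} [MeasurableSpace X] {μ : Measure X} [CoarseSpace X]
  {H : Type*} [NormedAddCommGroup H] [InnerProductSpace ℂ H] [CompleteSpace H]
  (ρ : controlledAlgebra μ →⋆ₐ[ℂ] (H →L[ℂ] H))

theorem mulFn_indicator_mul {s t : Set X} (hs : MeasurableSet s) (ht : MeasurableSet t) :
    mulFn μ (s.indicator 1) * mulFn μ (t.indicator 1) = mulFn μ ((s ∩ t).indicator 1) := by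
  rw [mulFn_mul (bddMeasurable_indicator hs) (bddMeasurable_indicator ht), inter_indicator_one]

/-- Continuity of `ρ` is not assumed, so the bound comes from algebra: `h² + k² = L²` with `k = √(L²
- h²)`, whence `‖ρ(h)v‖² + ‖ρ(k)v‖² = L²‖v‖²`. -/
theorem norm_representation_mulFn_le {h : X → ℝ} (hm : Measurable h) {L : ℝ} (hL : ∀ x, |h x| ≤ L)
    (hL0 : 0 ≤ L) (v : H) : ‖ρ (mulFn μ h) v‖ ≤ L * ‖v‖ := by
  have hh : BddMeasurable h := ⟨hm, L, hL⟩
  set k : X → ℝ := fun x => √(L ^ 2 - h x ^ 2) with hk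
  have hk0 : ∀ x, 0 ≤ L ^ 2 - h x ^ 2 := fun x => by
    rw [sub_nonneg]
    exact sq_le_sq' (abs_le.1 (hL x)).1 (abs_le.1 (hL x)).2
  have hkb : BddMeasurable k := by
    refine ⟨((measurable_const.sub (hm.pow_const 2)).sqrt), L, fun x => ?_⟩
    rw [abs_of_nonneg (Real.sqrt_nonneg _)]
    exact Real.sqrt_le_iff.2 ⟨hL0, by nlinarith [sq_nonneg (h x)]⟩
  have hsum : star (mulFn μ h) * mulFn μ h + star (mulFn μ k) * mulFn μ k =
      ((L ^ 2 : ℝ) : ℂ) • 1 := by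
    rw [star_mulFn hh, star_mulFn hkb, mulFn_mul hh hh, mulFn_mul hkb hkb,
      mulFn_add (hh.mul hh) (hkb.mul hkb), ← mulFn_const]
    congr 1
    ext x
    simp only [Pi.add_apply, Pi.mul_apply, hk, Real.mul_self_sqrt (hk0 x)]
    ring
  have h1 : ‖ρ (mulFn μ h) v‖ ^ 2 + ‖ρ (mulFn μ k) v‖ ^ 2 = L ^ 2 * ‖v‖ ^ 2 := by
    rw [norm_sq_representation, norm_sq_representation, ← map_add, ← inner_add_right,
      ← representation_add, hsum, representation_smul_one, inner_smul_right, inner_self_eq_norm_sq_to_K]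
    norm_cast
    exact (Complex.re_ofReal_mul _ _).trans rfl
  refine le_of_sq_le_sq ?_ (by positivity)
  nlinarith [sq_nonneg ‖ρ (mulFn μ k) v‖]

theorem norm_representation_indicator_le {s : Set X} (hs : MeasurableSet s) (v : H) :
    ‖ρ (mulFn μ (s.indicator 1)) v‖ ≤ ‖v‖ := by
  refine (norm_representation_mulFn_le ρ (bddMeasurable_indicator hs).1 (L := 1) (fun x => ?_)
    zero_le_one v).trans_eq (one_mul _)
  by_cases hx : x ∈ s <;> simp [hx]

end Representations

/-! ### Indicators in `L²` and averaging projections over blocks. -/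

section Indicators

variable {X : Type u} [MeasurableSpace X] {μ : Measure X}

open Classical in
variable (μ) in
/-- The indicator function of `s` as an element of `L²` (zero if `s` is not a measurable set of
finite measure). -/
noncomputable def l2ind (s : Set X) : Lp ℂ 2 μ :=
  if h : MeasurableSet s ∧ μ s ≠ ⊤ then indicatorConstLp 2 h.1 h.2 1 else 0

theorem coeFn_l2ind {s : Set X} (hs : MeasurableSet s) (hμs : μ s ≠ ⊤) :
    l2ind μ s =ᵐ[μ] s.indicator 1 := by
  rw [l2ind, dif_pos ⟨hs, hμs⟩]
  exact indicatorConstLp_coeFn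

theorem inner_l2ind {s : Set X} (hs : MeasurableSet s) (hμs : μ s ≠ ⊤) (η : Lp ℂ 2 μ) :
    inner ℂ (l2ind μ s) η = ∫ x in s, η x ∂μ := by
  rw [l2ind, dif_pos ⟨hs, hμs⟩]
  exact L2.inner_indicatorConstLp_one hs hμs η

theorem inner_l2ind_self {s : Set X} (hs : MeasurableSet s) (hμs : μ s ≠ ⊤) :
    inner ℂ (l2ind μ s) (l2ind μ s) = (μ.real s : ℂ) := by
  rw [inner_l2ind hs hμs, setIntegral_congr_ae (g := fun _ => (1 : ℂ)) hs]
  · simp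
  · filter_upwards [coeFn_l2ind hs hμs] with x hx hxs
    simp [hx, hxs]

theorem norm_sq_l2ind {s : Set X} (hs : MeasurableSet s) (hμs : μ s ≠ ⊤) :
    ‖l2ind μ s‖ ^ 2 = μ.real s := by
  rw [← inner_self_eq_norm_sq (𝕜 := ℂ), inner_l2ind_self hs hμs]
  exact Complex.ofReal_re _

end Indicators

section BlockProjection

variable {X : Type u} [MeasurableSpace X] {μ : Measure X} {κ : Type*} {B : κ → Set X}

variable (μ) in
/-- A family of disjoint measurable sets of finite positive measure. -/
structure BlockFamily (B : κ → Set X) : Prop where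
  measurableSet : ∀ k, MeasurableSet (B k)
  disjoint : Pairwise (Function.onFun Disjoint B)
  ne_zero : ∀ k, μ (B k) ≠ 0
  ne_top : ∀ k, μ (B k) ≠ ⊤

theorem BlockFamily.real_pos (hB : BlockFamily μ B) (k : κ) : 0 < μ.real (B k) :=
  ENNReal.toReal_pos (hB.ne_zero k) (hB.ne_top k)

theorem BlockFamily.eq_of_mem (hB : BlockFamily μ B) {j k : κ} {x : X} (hj : x ∈ B j)
    (hk : x ∈ B k) : j = k := by
  by_contra h
  exact disjoint_left.1 (hB.disjoint h) hj hk

variable (μ) in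
/-- The closed span of the indicator functions of the blocks. -/
noncomputable def blockSpan (B : κ → Set X) : Submodule ℂ (Lp ℂ 2 μ) :=
  (Submodule.span ℂ (range fun k => l2ind μ (B k))).topologicalClosure

instance : CompleteSpace (blockSpan μ B) :=
  (Submodule.isClosed_topologicalClosure _).completeSpace_coe

variable (μ) in
/-- The operator averaging over each of the blocks. -/
noncomputable def blockProj (B : κ → Set X) : Lp ℂ 2 μ →L[ℂ] Lp ℂ 2 μ :=
  (blockSpan μ B).starProjection

theorem star_blockProj : star (blockProj μ B) = blockProj μ B :=
  isSelfAdjoint_starProjection (blockSpan μ B)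

theorem blockProj_mul_self : blockProj μ B * blockProj μ B = blockProj μ B :=
  (Submodule.isIdempotentElem_starProjection (blockSpan μ B))

theorem norm_blockProj_le : ‖blockProj μ B‖ ≤ 1 := (blockSpan μ B).starProjection_norm_le

theorem inner_blockProj_left (ξ η : Lp ℂ 2 μ) :
    inner ℂ (blockProj μ B ξ) η = inner ℂ ξ (blockProj μ B η) :=
  (blockSpan μ B).inner_starProjection_left_eq_right ξ η

theorem blockProj_mem (η : Lp ℂ 2 μ) : blockProj μ B η ∈ blockSpan μ B :=
  Submodule.starProjection_apply_mem _ η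

theorem l2ind_mem_blockSpan (k : κ) : l2ind μ (B k) ∈ blockSpan μ B :=
  Submodule.le_topologicalClosure _ (Submodule.subset_span ⟨k, rfl⟩)

theorem blockProj_l2ind (k : κ) : blockProj μ B (l2ind μ (B k)) = l2ind μ (B k) :=
  Submodule.starProjection_eq_self_iff.2 (l2ind_mem_blockSpan k)

theorem mulOp_indicator_l2ind {s t : Set X} (hs : MeasurableSet s) (ht : MeasurableSet t)
    (hμt : μ t ≠ ⊤) : mulOp (linf μ (s.indicator 1)) (l2ind μ t) = l2ind μ (s ∩ t) := by
  apply Lp.ext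
  filter_upwards [coeFn_mulOp_linf (bddMeasurable_indicator hs) (l2ind μ t), coeFn_l2ind ht hμt,
    coeFn_l2ind (hs.inter ht) (ne_top_of_le_ne_top hμt (measure_mono inter_subset_right))]
    with x h1 h2 h3
  rw [h1, h2, h3]
  by_cases hxs : x ∈ s <;> by_cases hxt : x ∈ t <;> simp [hxs, hxt]

theorem l2ind_empty : l2ind μ ∅ = 0 := by
  apply Lp.ext
  filter_upwards [coeFn_l2ind (μ := μ) MeasurableSet.empty (by simp), Lp.coeFn_zero ℂ 2 μ]
    with x h1 h2
  rw [h1, h2]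
  simp

/-- Cutting to `B k` kills the indicators of the other blocks and fixes that of `B k`. The property
passes to the closed span because a line is closed. -/
theorem mulOp_indicator_mem_span (hB : BlockFamily μ B) (k : κ) {ζ : Lp ℂ 2 μ}
    (hζ : ζ ∈ blockSpan μ B) :
    mulOp (linf μ ((B k).indicator 1)) ζ ∈ Submodule.span ℂ {l2ind μ (B k)} := by
  have hcl : IsClosed ((Submodule.span ℂ {l2ind μ (B k)}).comap
      (mulOp (linf μ ((B k).indicator 1))).toLinearMap : Set (Lp ℂ 2 μ)) :=
    (Submodule.closed_of_finiteDimensional (Submodule.span ℂ {l2ind μ (B k)})).preimage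
      (mulOp (linf μ ((B k).indicator 1))).continuous
  refine Submodule.topologicalClosure_minimal _ ?_ hcl hζ
  rw [Submodule.span_le]
  rintro _ ⟨j, rfl⟩
  change mulOp (linf μ ((B k).indicator 1)) (l2ind μ (B j)) ∈
    Submodule.span ℂ {l2ind μ (B k)}
  rw [mulOp_indicator_l2ind (hB.1 k) (hB.1 j) (hB.4 j)]
  by_cases h : k = j
  · subst h
    rw [inter_self]
    exact Submodule.mem_span_singleton_self _
  · rw [(disjoint_iff_inter_eq_empty.1 (hB.2 h)), l2ind_empty]
    exact zero_mem _

theorem mulOp_compl_eq_zero [Countable κ] (hB : BlockFamily μ B) {ζ : Lp ℂ 2 μ}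
    (hζ : ζ ∈ blockSpan μ B) : mulOp (linf μ ((⋃ k, B k)ᶜ.indicator 1)) ζ = 0 := by
  have hcl : IsClosed ((⊥ : Submodule ℂ (Lp ℂ 2 μ)).comap
      (mulOp (linf μ ((⋃ k, B k)ᶜ.indicator 1))).toLinearMap : Set (Lp ℂ 2 μ)) :=
    (isClosed_singleton (x := (0 : Lp ℂ 2 μ))).preimage
      (mulOp (linf μ ((⋃ k, B k)ᶜ.indicator 1))).continuous
  refine Submodule.topologicalClosure_minimal _ ?_ hcl hζ
  rw [Submodule.span_le]
  rintro _ ⟨j, rfl⟩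
  change mulOp (linf μ ((⋃ k, B k)ᶜ.indicator 1)) (l2ind μ (B j)) = 0
  rw [mulOp_indicator_l2ind (MeasurableSet.iUnion hB.1).compl (hB.1 j) (hB.4 j),
    disjoint_iff_inter_eq_empty.1 (disjoint_compl_left_iff_subset.2 (subset_iUnion B j)),
    l2ind_empty]

theorem inner_mulOp_indicator {s : Set X} (hs : MeasurableSet s) (hμs : μ s ≠ ⊤) (η : Lp ℂ 2 μ) :
    inner ℂ (l2ind μ s) (mulOp (linf μ (s.indicator 1)) η) = inner ℂ (l2ind μ s) η := by
  apply inner_eq_of_ae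
  filter_upwards [coeFn_mulOp_linf (bddMeasurable_indicator hs) η, coeFn_l2ind hs hμs] with x h1 h2
  rw [h1, h2]
  by_cases hxs : x ∈ s <;> simp [hxs]

/-- The average of `η` over the set `s`. -/
noncomputable def avg (η : Lp ℂ 2 μ) (s : Set X) : ℂ := (μ.real s : ℂ)⁻¹ * ∫ x in s, η x ∂μ

/-- Pairing with the indicator of `B k`, which the self-adjoint projection fixes, determines the
coefficient. -/
theorem mulOp_indicator_blockProj (hB : BlockFamily μ B) (k : κ) (η : Lp ℂ 2 μ) :
    mulOp (linf μ ((B k).indicator 1)) (blockProj μ B η) = avg η (B k) • l2ind μ (B k) := by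
  obtain ⟨c, hc⟩ := Submodule.mem_span_singleton.1
    (mulOp_indicator_mem_span hB k (blockProj_mem (B := B) η))
  have h1 := inner_mulOp_indicator (hB.1 k) (hB.4 k) (blockProj μ B η)
  rw [← hc, inner_smul_right, inner_l2ind_self (hB.1 k) (hB.4 k), ← inner_blockProj_left,
    blockProj_l2ind, inner_l2ind (hB.1 k) (hB.4 k)] at h1
  rw [← hc, avg, ← h1]
  have : (μ.real (B k) : ℂ) ≠ 0 := Complex.ofReal_ne_zero.2 (hB.real_pos k).ne'
  congr 1
  field_simp

theorem coeFn_blockProj [Countable κ] (hB : BlockFamily μ B) (η : Lp ℂ 2 μ) :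
    ∀ᵐ x ∂μ, (∀ k, x ∈ B k → blockProj μ B η x = avg η (B k)) ∧
      (x ∉ ⋃ k, B k → blockProj μ B η x = 0) := by
  have h1 : ∀ᵐ x ∂μ, ∀ k, x ∈ B k → blockProj μ B η x = avg η (B k) := by
    rw [ae_all_iff]
    intro k
    have h := mulOp_indicator_blockProj hB k η
    filter_upwards [coeFn_mulOp_linf (bddMeasurable_indicator (hB.1 k)) (blockProj μ B η),
      Lp.coeFn_smul (avg η (B k)) (l2ind μ (B k)), coeFn_l2ind (hB.1 k) (hB.4 k)]
      with x h1 h2 h3 hx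
    rw [h, h2, Pi.smul_apply, h3] at h1
    simpa [hx] using h1.symm
  have h2 := mulOp_compl_eq_zero hB (blockProj_mem (B := B) η)
  filter_upwards [h1, coeFn_mulOp_linf (bddMeasurable_indicator (MeasurableSet.iUnion hB.1).compl)
    (blockProj μ B η), Lp.coeFn_zero ℂ 2 μ] with x h1 h3 h4
  refine ⟨h1, fun hx => ?_⟩
  rw [h2, h4, indicator_of_mem (mem_compl hx)] at h3
  simpa using h3.symm

theorem avg_eq_zero {η : Lp ℂ 2 μ} {U s : Set X} (hη : VanishesOff η U) (hs : MeasurableSet s)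
    (h : s ∩ U = ∅) : avg η s = 0 := by
  rw [avg, setIntegral_congr_ae (g := fun _ => (0 : ℂ)) hs]
  · simp
  · filter_upwards [hη] with x hx hxs
    exact hx fun hxU => (h ▸ (⟨hxs, hxU⟩ : x ∈ s ∩ U) : x ∈ (∅ : Set X))

theorem vanishesOff_blockProj [Countable κ] (hB : BlockFamily μ B) {U : Set X} {ξ : Lp ℂ 2 μ}
    (hξ : VanishesOff ξ U) : VanishesOff (blockProj μ B ξ) (thicken (blockSet (range B)) U) := by
  filter_upwards [coeFn_blockProj hB ξ] with x hx hxU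
  by_cases h : x ∈ ⋃ k, B k
  · obtain ⟨k, hk⟩ := mem_iUnion.1 h
    rw [hx.1 k hk]
    refine avg_eq_zero hξ (hB.1 k) (eq_empty_iff_forall_notMem.2 ?_)
    rintro y ⟨hyk, hyU⟩
    exact hxU ⟨y, hyU, mem_blockSet_range.2 ⟨k, hk, hyk⟩⟩
  · exact hx.2 h

theorem BlockFamily.measurableRel [Countable κ] (hB : BlockFamily μ B) :
    MeasurableRel (blockSet (range B)) :=
  measurableRel_blockSet (countable_range B) (by rintro _ ⟨k, rfl⟩; exact hB.1 k)

theorem supportedOn_blockProj [Countable κ] (hB : BlockFamily μ B) :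
    SupportedOn (blockSet (range B)) (blockProj μ B) := by
  rw [supportedOn_iff hB.measurableRel]
  intro U _ ξ hξ
  rw [star_blockProj]
  exact vanishesOff_blockProj hB hξ

/-- The projection produces a constant on each block. Multiplying it by `h` and averaging again only
sees the integral of `h` over the block. -/
theorem blockProj_mul_mulOp_mul [Countable κ] (hB : BlockFamily μ B) {g h : X → ℝ}
    (hg : BddMeasurable g) (hh : BddMeasurable h)
    (hgh : ∀ k, ∫ x in B k, g x ∂μ = ∫ x in B k, h x ∂μ) :
    blockProj μ B * mulOp (linf μ g) * blockProj μ B =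
      blockProj μ B * mulOp (linf μ h) * blockProj μ B := by
  refine ContinuousLinearMap.ext fun η => Lp.ext ?_
  have key : ∀ f : X → ℝ, BddMeasurable f → ∀ k,
      ∫ x in B k, mulOp (linf μ f) (blockProj μ B η) x ∂μ =
        ((∫ x in B k, f x ∂μ : ℝ) : ℂ) * avg η (B k) := by
    intro f hf k
    rw [← integral_complex_ofReal, ← integral_mul_const]
    refine setIntegral_congr_ae (hB.1 k) ?_
    filter_upwards [coeFn_mulOp_linf hf (blockProj μ B η), coeFn_blockProj hB η] with x h1 h2 hx
    rw [h1, h2.1 k hx]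
  simp only [mul_apply_eq_comp]
  filter_upwards [coeFn_blockProj hB (mulOp (linf μ g) (blockProj μ B η)),
    coeFn_blockProj hB (mulOp (linf μ h) (blockProj μ B η))] with x h1 h2
  by_cases hx : x ∈ ⋃ k, B k
  · obtain ⟨k, hk⟩ := mem_iUnion.1 hx
    rw [h1.1 k hk, h2.1 k hk, avg, avg, key g hg, key h hh, hgh]
  · rw [h1.2 hx, h2.2 hx]

theorem integral_conj_eq_inner_l2ind {s : Set X} (hs : MeasurableSet s) (hμs : μ s ≠ ⊤)
    {ξ : Lp ℂ 2 μ} (hξ : VanishesOff ξ s) : ∫ x, conj (ξ x) ∂μ = inner ℂ ξ (l2ind μ s) := by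
  rw [L2.inner_def]
  apply integral_congr_ae
  filter_upwards [hξ, coeFn_l2ind hs hμs] with x h1 h2
  by_cases hx : x ∈ s
  · simp [h2, hx]
  · simp [h1 hx]

end BlockProjection

/-! ### Averaging projections in the controlled algebra, and testing `Φ`. -/

section BlockElement

variable {X : Type u} [MeasurableSpace X] {μ : Measure X} [CoarseSpace X] {κ : Type*}
  {B : κ → Set X} [Countable κ]

/-- The operator averaging over blocks, as an element of `ℂ_cs[X]`. -/
noncomputable def blockElem (hB : BlockFamily μ B) (hc : IsControlled (blockSet (range B))) :
    controlledAlgebra μ :=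
  ⟨blockProj μ B, _, hc, isSymmetric_blockSet _, hB.measurableRel, supportedOn_blockProj hB⟩

theorem star_blockElem (hB : BlockFamily μ B) (hc : IsControlled (blockSet (range B))) :
    star (blockElem hB hc) = blockElem hB hc := Subtype.ext star_blockProj

theorem blockElem_mul_self (hB : BlockFamily μ B) (hc : IsControlled (blockSet (range B))) :
    blockElem hB hc * blockElem hB hc = blockElem hB hc := Subtype.ext blockProj_mul_self

theorem blockElem_ne_zero [Nonempty κ] (hB : BlockFamily μ B)
    (hc : IsControlled (blockSet (range B))) : blockElem hB hc ≠ 0 := by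
  intro h
  obtain ⟨k⟩ := ‹Nonempty κ›
  have h1 : l2ind μ (B k) = 0 := by
    rw [← blockProj_l2ind k]
    exact congrArg (fun T : controlledAlgebra μ => T.1 (l2ind μ (B k))) h
  have h2 := norm_sq_l2ind (hB.1 k) (hB.4 k)
  rw [h1] at h2
  have := hB.real_pos k
  simp at h2
  linarith

theorem inBlocks_blockElem (hB : BlockFamily μ B) (hc : IsControlled (blockSet (range B)))
    {E : Set (X × X)} (hE : blockSet (range B) ⊆ E) {ε : ℝ}
    (hε : ∀ k, ENNReal.ofReal ε ≤ μ (B k)) : InBlocks E ε (blockElem hB hc) := by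
  refine ⟨range B, ⟨?_, hE, ?_, ?_⟩, supportedOn_blockProj hB⟩
  · rintro _ ⟨k, rfl⟩
    exact hB.1 k
  · rintro _ ⟨j, rfl⟩ _ ⟨k, rfl⟩ h
    exact hB.2 fun hjk => h (by rw [hjk])
  · rintro _ ⟨k, rfl⟩
    exact hε k

theorem isPhi_blockElem (hμ : UniformlyBounded μ) (hB : BlockFamily μ B)
    (hc : IsControlled (blockSet (range B))) :
    IsPhi (blockElem hB hc) (linf μ ((⋃ k, B k).indicator 1)) := by
  intro U ξ hU hUm hξ
  rw [star_blockElem hB hc]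
  change _ = ∫ x, conj (blockProj μ B ξ x) ∂μ
  set S := thicken (blockSet (range B)) U
  have hSm : MeasurableSet S := hB.measurableRel U hUm
  have hSf : μ S ≠ ⊤ := hμ.measure_ne_top (hU.thicken hc) hSm
  -- No block crosses the boundary of `S`, so the average of the indicator of `S` over a block
  -- meeting `U` is exactly `1`.
  have hBS : ∀ k, B k ⊆ S ∨ B k ∩ S = ∅ := by
    intro k
    rw [or_iff_not_imp_right, ← Ne, ← nonempty_iff_ne_empty]
    rintro ⟨x, hxk, y, hy, hxy⟩ z hz
    obtain ⟨j, hxj, hyj⟩ := mem_blockSet_range.1 hxy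
    obtain rfl := hB.eq_of_mem hxk hxj
    exact ⟨y, hy, mem_blockSet_range.2 ⟨k, hz, hyj⟩⟩
  rw [integral_conj_eq_inner_l2ind hSm hSf (vanishesOff_blockProj hB hξ), inner_blockProj_left,
    L2.inner_def]
  apply integral_congr_ae
  filter_upwards [hξ, coeFn_blockProj hB (l2ind μ S),
    coeFn_linf (μ := μ) (bddMeasurable_indicator (MeasurableSet.iUnion hB.1))] with x h1 h2 h3
  by_cases hxU : x ∈ U
  · rw [h3, RCLike.inner_apply, mul_comm]
    congr 1
    by_cases hx : x ∈ ⋃ k, B k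
    · obtain ⟨k, hk⟩ := mem_iUnion.1 hx
      have hkS : B k ⊆ S := (hBS k).resolve_right fun h => (h ▸
        (⟨hk, x, hxU, mem_blockSet_range.2 ⟨k, hk, hk⟩⟩ : x ∈ B k ∩ S) : x ∈ (∅ : Set X))
      rw [h2.1 k hk, avg, setIntegral_congr_ae (g := fun _ => (1 : ℂ)) (hB.1 k)]
      · have := (hB.real_pos k).ne'
        simp [hx, this]
      · filter_upwards [coeFn_l2ind hSm hSf] with y hy hyk
        simp [hy, hkS hyk]
    · rw [h2.2 hx]
      simp [hx]
  · simp [h1 hxU]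

end BlockElement

section Phi

variable {X : Type u} [MeasurableSpace X] {μ : Measure X} [CoarseSpace X]

/-- The constant function `1` need not lie in `L²`. Finite-measure indicators replace it, as long as
`S` carries `T* ξ` and `S'` contains the support of `ξ`. -/
theorem IsPhi.inner_l2ind {T : controlledAlgebra μ} {f : Lp ℂ ∞ μ} (hT : IsPhi T f) {U S S' : Set X}
    (hU : Bounded U) (hUm : MeasurableSet U) {ξ : Lp ℂ 2 μ} (hξ : VanishesOff ξ U)
    (hS : MeasurableSet S) (hSf : μ S ≠ ⊤) (hTξ : VanishesOff (star T.1 ξ) S)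
    (hS' : MeasurableSet S') (hSf' : μ S' ≠ ⊤) (hUS : U ⊆ S') :
    inner ℂ ξ (T.1 (l2ind μ S)) = inner ℂ ξ (mulOp f (l2ind μ S')) := by
  rw [← ContinuousLinearMap.adjoint_inner_left, ← ContinuousLinearMap.star_eq_adjoint,
    ← integral_conj_eq_inner_l2ind hS hSf hTξ]
  refine (hT U ξ hU hUm hξ).symm.trans ?_
  rw [L2.inner_def]
  apply integral_congr_ae
  filter_upwards [hξ, coeFn_mulOp f (l2ind μ S'), coeFn_l2ind hS' hSf'] with x h1 h2 h3
  by_cases hx : x ∈ U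
  · rw [h2, h3]
    simp [hUS hx, mul_comm]
  · simp [h1 hx]

end Phi

/-! ### Bounded spaces. -/

section BoundedSpaces

variable {X : Type u} [MeasurableSpace X] {μ : Measure X}

theorem vanishesOff_univ (ξ : Lp ℂ 2 μ) : VanishesOff ξ univ :=
  Filter.Eventually.of_forall fun x hx => absurd (mem_univ x) hx

theorem blockProj_unit_eq_smul (hB : BlockFamily μ fun _ : Unit => (univ : Set X)) (η : Lp ℂ 2 μ) :
    blockProj μ (fun _ : Unit => (univ : Set X)) η = avg η univ • l2ind μ univ := by
  apply Lp.ext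
  filter_upwards [coeFn_blockProj hB η, Lp.coeFn_smul (avg η univ) (l2ind μ univ),
    coeFn_l2ind (hB.1 ()) (hB.4 ())] with x h1 h2 h3
  rw [h1.1 () (mem_univ x), h2, Pi.smul_apply, h3]
  simp

variable [CoarseSpace X]

theorem amenable_of_bounded [Nonempty X] (hX : Bounded (univ : Set X)) : Amenable μ := by
  intro E _ _ ε hε
  refine ⟨univ, univ_nonempty, hX, MeasurableSet.univ, ?_⟩
  calc μ (thicken E univ) ≤ 1 * μ univ := by
        rw [one_mul]
        exact measure_mono (subset_univ _)
    _ ≤ _ := by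
        gcongr
        rw [ENNReal.one_le_ofReal]
        linarith

theorem geometricPropertyT_of_bounded [Nonempty X] [MeasurableSingletonClass X]
    (hX : Bounded (univ : Set X)) (hμ : UniformlyBounded μ) (hg : ∃ E, Gordo μ E) :
    GeometricPropertyT μ := by
  obtain ⟨F, -, -, -, c, hc, hcF⟩ := hg
  have hcX : ENNReal.ofReal c ≤ μ univ :=
    (hcF (Classical.arbitrary X)).trans (measure_mono (subset_univ _))
  have hf : μ univ ≠ ⊤ := hμ.measure_ne_top hX MeasurableSet.univ
  have hB : BlockFamily μ fun _ : Unit => (univ : Set X) :=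
    ⟨fun _ => MeasurableSet.univ, fun _ _ h => absurd rfl h,
      fun _ => ((ENNReal.ofReal_pos.2 hc).trans_le hcX).ne', fun _ => hf⟩
  have hcu : IsControlled (univ : Set (X × X)) := by
    rw [← univ_prod_univ]
    exact hX
  have hcB : IsControlled (blockSet (range fun _ : Unit => (univ : Set X))) :=
    CoarseSpace.mono hcu (subset_univ _)
  refine ⟨univ, c, 1, hcu, hc, one_pos, ?_⟩
  intro H _ _ _ ρ v hv hv1
  set P := blockElem hB hcB
  have hPhi : IsPhi P (linf μ ((⋃ _ : Unit, (univ : Set X)).indicator 1)) :=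
    isPhi_blockElem hμ hB hcB
  have hone : mulElem (linf μ ((⋃ _ : Unit, (univ : Set X)).indicator 1)) =
      (1 : controlledAlgebra μ) := by
    have h := mulFn_const (μ := μ) (1 : ℝ)
    rw [Complex.ofReal_one, one_smul] at h
    rw [← h, mulFn, iUnion_const, indicator_univ]
    rfl
  refine ⟨P, _, blockElem_ne_zero hB hcB, inBlocks_blockElem hB hcB (subset_univ _) fun _ => hcX,
    hPhi, ?_⟩
  -- The range of `P` consists of multiples of the indicator of `X`, on which `T` and multiplication
  -- by `f` agree.
  have hmem : ρ P v ∈ constantVectors ρ := by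
    intro T f hT
    rw [← mul_apply_eq_comp, ← mul_apply_eq_comp, ← map_mul, ← map_mul]
    congr 2
    apply Subtype.ext
    refine ContinuousLinearMap.ext fun η => ?_
    change T.1 (blockProj μ _ η) = mulOp f (blockProj μ _ η)
    rw [blockProj_unit_eq_smul hB, map_smul, map_smul]
    congr 1
    refine ext_inner_left ℂ fun ξ => ?_
    exact hT.inner_l2ind hX MeasurableSet.univ (vanishesOff_univ ξ) MeasurableSet.univ hf
      (vanishesOff_univ _) MeasurableSet.univ hf le_rfl
  -- As `P` is a projection, `‖ρ(P)v‖² = ⟨v, ρ(P)v⟩`, which vanishes by orthogonality.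
  have h0 : ρ P v = 0 := by
    rw [← norm_eq_zero, ← sq_eq_zero_iff, norm_sq_representation, star_blockElem hB hcB,
      blockElem_mul_self hB hcB, ← inner_conj_symm,
      (Submodule.mem_orthogonal _ _).1 hv _ hmem]
    simp
  rw [hone, map_sub, map_one, sub_apply, h0, zero_sub, norm_neg,
    one_apply_eq_self, hv1, one_mul]
  exact norm_blockProj_le

end BoundedSpaces

/-! ### Partition into cells of comparable measure. -/

section Cells

variable {X : Type u} [MeasurableSpace X] [CoarseSpace X]

/-- A partition of `X`, given by the fibres of `π`, into uniformly bounded measurable sets whose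
measure is at least `c`. -/
structure Cells (μ : Measure X) {ι : Type*} (π : X → ι) (c : ℝ) : Prop where
  measurableSet : ∀ J : Set ι, MeasurableSet (π ⁻¹' J)
  controlled : IsControlled {p : X × X | π p.1 = π p.2}
  pos : 0 < c
  le_measure : ∀ i, ENNReal.ofReal c ≤ μ (π ⁻¹' {i})

/-- The centres form a maximal set `I` of points whose gordo neighbourhoods `N i` are disjoint.
Maximality makes the double neighbourhoods `G i` cover `X`. Only finitely many centres lie in a
bounded set, so `I` is countable and the cover can be made disjoint measurably. -/
theorem exists_cells [MeasurableSingletonClass X] {μ : Measure X}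
    (hc : CountablyCovered X) (hb : UniformlyBounded μ) (hg : ∃ F, Gordo μ F) :
    ∃ (ι : Type u) (_ : Countable ι) (π : X → ι) (c : ℝ), Cells μ π c := by
  obtain ⟨F, hF⟩ := hg
  obtain ⟨B, hB, hBu⟩ := hc
  obtain ⟨I, hI⟩ := zorn_subset {I : Set X | I.PairwiseDisjoint fun i => thicken F {i}} (by
    intro c hcs hcc
    refine ⟨⋃₀ c, ?_, fun s hs => subset_sUnion_of_mem hs⟩
    exact (pairwiseDisjoint_sUnion hcc.directedOn).2 fun s hs => hcs hs)
  have hId : I.PairwiseDisjoint fun i => thicken F {i} := hI.prop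
  have hIc : I.Countable := by
    have : I = ⋃ n, I ∩ B n := by rw [← inter_iUnion, hBu, inter_univ]
    rw [this]
    exact countable_iUnion fun n =>
      (finite_of_gordo hb hF (hB n) inter_subset_right (hId.subset inter_subset_left)).countable
  obtain ⟨hFc, hFs, hFm, c, hc, hcF⟩ := hF
  have hne : ∀ x, (thicken F {x}).Nonempty := fun x =>
    nonempty_of_measure_ne_zero (μ := μ) (lt_of_lt_of_le (ENNReal.ofReal_pos.2 hc) (hcF x)).ne'
  have : Countable I := hIc.to_subtype
  obtain ⟨e, he⟩ := exists_injective_nat I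
  let N : I → Set X := fun i => thicken F {i.1}
  let G : I → Set X := fun i => thicken F (N i)
  have hNm : ∀ i, MeasurableSet (N i) := fun i => hFm _ (measurableSet_singleton i.1)
  have hGm : ∀ i, MeasurableSet (G i) := fun i => hFm _ (hNm i)
  have hNd : ∀ {i j : I} {x : X}, x ∈ N i → x ∈ N j → i = j := by
    intro i j x hi hj
    by_contra h
    exact disjoint_left.1 (hId i.2 j.2 fun h' => h (Subtype.ext h')) hi hj
  -- Each `N i` is reserved for its own index: it meets no `K j` with `j ≠ i`. Making the `K i`
  -- disjoint along the enumeration `e` therefore leaves `N i` inside its cell, which keeps the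
  -- lower bound on the measure.
  let K : I → Set X := fun i => N i ∪ (G i \ ⋃ j, N j)
  have hKm : ∀ i, MeasurableSet (K i) := fun i =>
    (hNm i).union ((hGm i).diff (MeasurableSet.iUnion hNm))
  have hK : ∀ x, ∃ i, x ∈ K i := by
    intro x
    by_cases hx : x ∈ ⋃ j, N j
    · obtain ⟨i, hi⟩ := mem_iUnion.1 hx
      exact ⟨i, Or.inl hi⟩
    have key : ∃ i ∈ I, ¬ Disjoint (thicken F {x}) (thicken F {i}) := by
      by_contra hcon
      push Not at hcon
      have hins : (insert x I).PairwiseDisjoint fun i => thicken F {i} :=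
        hId.insert fun j hj _ => hcon j hj
      have hxI : x ∈ I := hI.le_of_ge hins (subset_insert x I) (mem_insert x I)
      exact (hne x).ne_empty (disjoint_self.1 (hcon x hxI))
    obtain ⟨i, hi, hd⟩ := key
    obtain ⟨y, ⟨a, rfl, hy⟩, hy'⟩ := not_disjoint_iff.1 hd
    exact ⟨⟨i, hi⟩, Or.inr ⟨⟨y, hy', (hFs _ _).1 hy⟩, hx⟩⟩
  let A : I → Set X := fun i => K i \ ⋃ j ∈ {j | e j < e i}, K j
  have hAm : ∀ i, MeasurableSet (A i) := fun i =>
    (hKm i).diff (MeasurableSet.biUnion (to_countable _) fun j _ => hKm j)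
  have hA : ∀ x, ∃ i, x ∈ A i := by
    intro x
    obtain ⟨i, hi, hmin⟩ := (measure e).wf.has_min {i | x ∈ K i} (hK x)
    refine ⟨i, hi, fun h => ?_⟩
    obtain ⟨j, hj, hxj⟩ := mem_iUnion₂.1 h
    exact hmin j hxj hj
  have hAd : ∀ {i j : I} {x : X}, x ∈ A i → x ∈ A j → i = j := by
    intro i j x hi hj
    refine he (le_antisymm ?_ ?_)
    · by_contra h
      exact hi.2 (mem_biUnion (show j ∈ {j | e j < e i} from not_le.1 h) hj.1)
    · by_contra h
      exact hj.2 (mem_biUnion (show i ∈ {i | e i < e j} from not_le.1 h) hi.1)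
  have hNA : ∀ i, N i ⊆ A i := by
    intro i x hx
    refine ⟨Or.inl hx, fun h => ?_⟩
    obtain ⟨j, hj, hxj⟩ := mem_iUnion₂.1 h
    rcases hxj with hxj | hxj
    · rw [hNd hxj hx] at hj
      exact lt_irrefl (e i) hj
    · exact hxj.2 (mem_iUnion.2 ⟨i, hx⟩)
  choose π hπ using hA
  have hpre : ∀ i, π ⁻¹' {i} = A i := by
    intro i
    ext x
    exact ⟨fun h => h ▸ hπ x, fun h => hAd (hπ x) h⟩
  have hD : IsControlled ({p : X × X | ∃ i : I, p.1 ∈ G i ∧ p.2 ∈ G i}) := by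
    refine mono (comp (comp hFc hFc) (comp hFc hFc)) ?_
    rintro ⟨x, y⟩ ⟨i, ⟨a, ⟨b, rfl, hab⟩, hxa⟩, ⟨a', ⟨b', hb', hab'⟩, hya⟩⟩
    obtain rfl : b' = i.1 := hb'
    exact ⟨i.1, ⟨a, hxa, hab⟩, ⟨a', (hFs _ _).1 hab', (hFs _ _).1 hya⟩⟩
  have hD' : IsControlled ({p : X × X | ∃ i : I, p.1 ∈ N i ∧ p.2 ∈ N i}) := by
    refine mono (comp hFc hFc) ?_
    rintro ⟨x, y⟩ ⟨i, ⟨a, ha, hxa⟩, ⟨b, hb, hyb⟩⟩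
    obtain rfl : a = i.1 := ha
    obtain rfl : b = i.1 := hb
    exact ⟨i.1, hxa, (hFs _ _).1 hyb⟩
  have hD'' : IsControlled ({p : X × X | ∃ i : I, p.1 ∈ N i ∧ p.2 ∈ G i}) := by
    refine mono (comp hFc (comp hFc hFc)) ?_
    rintro ⟨x, y⟩ ⟨i, ⟨a, ha, hxa⟩, ⟨b', ⟨b, hb, hbb⟩, hya⟩⟩
    obtain rfl : a = i.1 := ha
    obtain rfl : b = i.1 := hb
    exact ⟨i.1, hxa, b', (hFs _ _).1 hbb, (hFs _ _).1 hya⟩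
  refine ⟨I, hIc.to_subtype, π, c, ?_, ?_, hc, fun i => ?_⟩
  · intro J
    have : π ⁻¹' J = ⋃ i ∈ J, A i := by
      rw [← biUnion_preimage_singleton]
      exact iUnion₂_congr fun i _ => hpre i
    rw [this]
    exact MeasurableSet.biUnion (to_countable _) fun i _ => hAm i
  · refine mono (union (union hD hD') (union hD'' (inv hD''))) ?_
    rintro ⟨x, y⟩ hxy
    have hx : x ∈ K (π x) := (hπ x).1
    have hy : y ∈ K (π x) := by
      rw [show π x = π y from hxy]
      exact (hπ y).1
    rcases hx with hx | hx <;> rcases hy with hy | hy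
    · exact Or.inl (Or.inr ⟨_, hx, hy⟩)
    · exact Or.inr (Or.inl ⟨_, hx, hy.1⟩)
    · exact Or.inr (Or.inr ⟨_, hy, hx.1⟩)
    · exact Or.inl (Or.inl ⟨_, hx.1, hy.1⟩)
  · rw [hpre]
    exact (hcF i).trans (measure_mono (hNA i))

end Cells

theorem preimage_image_eq_thicken {X : Type u} {ι : Type*} {π : X → ι} (T : Set X) :
    π ⁻¹' (π '' T) = thicken {p : X × X | π p.1 = π p.2} T := by
  ext y
  constructor
  · rintro ⟨x, hx, hxy⟩
    exact ⟨x, hx, hxy.symm⟩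
  · rintro ⟨x, hx, hxy⟩
    exact ⟨x, hx, Eq.symm hxy⟩

section Cells

variable {X : Type u} [MeasurableSpace X] [CoarseSpace X] {μ : Measure X} {ι : Type*} {π : X → ι}
  {c : ℝ}

theorem Cells.measure_pos (h : Cells μ π c) (i : ι) : 0 < μ (π ⁻¹' {i}) :=
  (ENNReal.ofReal_pos.2 h.pos).trans_le (h.le_measure i)

theorem Cells.nonempty (h : Cells μ π c) (i : ι) : (π ⁻¹' {i}).Nonempty :=
  nonempty_of_measure_ne_zero (h.measure_pos i).ne'

theorem Cells.bounded (h : Cells μ π c) (i : ι) : Bounded (π ⁻¹' {i}) := by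
  refine mono h.controlled ?_
  rintro ⟨x, y⟩ ⟨hx, hy⟩
  exact Eq.trans hx (Eq.symm hy)

theorem Cells.measure_ne_top (h : Cells μ π c) (hμ : UniformlyBounded μ) (i : ι) :
    μ (π ⁻¹' {i}) ≠ ⊤ := hμ.measure_ne_top (h.bounded i) (h.measurableSet _)

theorem Cells.le_real (h : Cells μ π c) (hμ : UniformlyBounded μ) (i : ι) :
    c ≤ μ.real (π ⁻¹' {i}) :=
  (ENNReal.ofReal_le_iff_le_toReal (h.measure_ne_top hμ i)).1 (h.le_measure i)

theorem Cells.exists_measure_le (h : Cells μ π c) (hμ : UniformlyBounded μ) :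
    ∃ C : NNReal, ∀ i, μ (π ⁻¹' {i}) ≤ C := by
  obtain ⟨C, hC⟩ := hμ _ h.controlled
  refine ⟨C, fun i => hC _ (h.measurableSet _) ?_⟩
  rintro ⟨x, y⟩ ⟨hx, hy⟩
  exact Eq.trans hx (Eq.symm hy)

theorem Cells.bounded_finset (h : Cells μ π c) (hconn : Connected X) (s : Finset ι) :
    Bounded (π ⁻¹' (s : Set ι)) := by
  have : π ⁻¹' (s : Set ι) = ⋃ i ∈ s, π ⁻¹' {i} := by
    ext x
    simp
  rw [this]
  exact bounded_biUnion_finset hconn s _ fun i _ => h.bounded i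

theorem Cells.measure_finset (h : Cells μ π c) (s : Finset ι) :
    μ (π ⁻¹' (s : Set ι)) = ∑ i ∈ s, μ (π ⁻¹' {i}) := by
  have : π ⁻¹' (s : Set ι) = ⋃ i ∈ s, π ⁻¹' {i} := by
    ext x
    simp
  rw [this, measure_biUnion_finset _ fun i _ => h.measurableSet _]
  intro i _ j _ hij
  exact Disjoint.preimage π (by simpa using hij)

theorem Cells.card_le_measure (h : Cells μ π c) (s : Finset ι) :
    s.card * ENNReal.ofReal c ≤ μ (π ⁻¹' (s : Set ι)) := by
  rw [h.measure_finset, ← nsmul_eq_mul]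
  exact Finset.card_nsmul_le_sum _ _ _ fun i _ => h.le_measure i

theorem Cells.measure_le_card (h : Cells μ π c) {C : NNReal} (hC : ∀ i, μ (π ⁻¹' {i}) ≤ C)
    (s : Finset ι) : μ (π ⁻¹' (s : Set ι)) ≤ s.card * C := by
  rw [h.measure_finset, ← nsmul_eq_mul]
  exact Finset.sum_le_card_nsmul _ _ _ fun i _ => hC i

/-- A bounded union of cells has finite measure, and every cell contributes at least `c`. -/
theorem Cells.finite_of_bounded (h : Cells μ π c) (hμ : UniformlyBounded μ) {J : Set ι}
    (hJ : Bounded (π ⁻¹' J)) : J.Finite := by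
  by_contra hinf
  have htop := hμ.measure_ne_top hJ (h.measurableSet J)
  have hc : ENNReal.ofReal c ≠ 0 := (ENNReal.ofReal_pos.2 h.pos).ne'
  obtain ⟨n, hn⟩ := ENNReal.exists_nat_mul_gt hc htop
  obtain ⟨s, hsJ, hs⟩ := Set.Infinite.exists_subset_card_eq hinf n
  have h1 := h.card_le_measure s
  rw [hs] at h1
  exact absurd (h1.trans (measure_mono (preimage_mono hsJ))) (not_le.2 hn)

end Cells

/-! ### Expansion from non-amenability, injections and colourings. -/

section Expansion

/-- The cells met by the `R`-thickening of a cell. -/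
def nbhd {X : Type u} {ι : Type*} (π : X → ι) (R : Set (X × X)) (i : ι) : Set ι := π '' thicken R (π ⁻¹' {i})

variable {X : Type u} [MeasurableSpace X] [CoarseSpace X] {μ : Measure X}

/-- Non-amenability gives one relation that expands every non-empty bounded measurable set by a
factor `1 + ε`. Its powers expand by any prescribed factor. -/
theorem exists_expanding (hne : ¬ Amenable μ) (K : ℕ) :
    ∃ R : Set (X × X), IsControlled R ∧ MeasurableRel R ∧
      ∀ U : Set X, U.Nonempty → Bounded U → MeasurableSet U → K * μ U ≤ μ (thicken R U) := by
  simp only [Amenable, not_forall, not_exists, not_and, not_le] at hne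
  obtain ⟨E, hE, hEm, ε, hε, hexp⟩ := hne
  have key : ∀ n : ℕ, ∃ R : Set (X × X), IsControlled R ∧ MeasurableRel R ∧
      ∀ U : Set X, U.Nonempty → Bounded U → MeasurableSet U →
        (thicken R U).Nonempty ∧ ENNReal.ofReal (1 + ε) ^ n * μ U ≤ μ (thicken R U) := by
    intro n
    induction n with
    | zero =>
      refine ⟨_, diagonal, measurableRel_diagonal, fun U hU _ _ => ?_⟩
      have : thicken {p : X × X | p.1 = p.2} U = U := by
        ext y
        simp [thicken]
      rw [this]
      exact ⟨hU, by simp⟩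
    | succ n ih =>
      obtain ⟨R, hR, hRm, hRU⟩ := ih
      refine ⟨_, comp hE hR, measurableRel_comp hEm hRm, fun U hU hUb hUm => ?_⟩
      rw [thicken_comp]
      obtain ⟨h1, h2⟩ := hRU U hU hUb hUm
      have h3 := hexp _ h1 (hUb.thicken hR) (hRm U hUm)
      -- The strict inequality forces positive measure; non-emptiness is needed to apply the
      -- expansion again.
      refine ⟨nonempty_of_measure_ne_zero (μ := μ) (bot_le.trans_lt h3).ne', ?_⟩
      rw [pow_succ', mul_assoc]
      exact (mul_le_mul_right h2 _).trans h3.le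
  obtain ⟨n, hn⟩ := pow_unbounded_of_one_lt (K : ℝ) (show 1 < 1 + ε by linarith)
  obtain ⟨R, hR, hRm, hRU⟩ := key n
  refine ⟨R, hR, hRm, fun U hU hUb hUm => le_trans ?_ (hRU U hU hUb hUm).2⟩
  gcongr
  rw [← ENNReal.ofReal_pow (by linarith), ← ENNReal.ofReal_natCast]
  exact ENNReal.ofReal_le_ofReal hn.le

theorem isControlled_nbhd {ι : Type*} {π : X → ι} {c : ℝ} (h : Cells μ π c) {R : Set (X × X)}
    (hR : IsControlled R) : IsControlled {p : X × X | π p.1 ∈ nbhd π R (π p.2)} := by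
  refine mono (comp (comp h.controlled hR) h.controlled) ?_
  rintro ⟨x, y⟩ ⟨a, ⟨b, hb, hab⟩, hax⟩
  exact ⟨b, ⟨a, Eq.symm hax, hab⟩, hb⟩

/-- Hall's theorem for `K` copies of each cell, where a copy of `i` may choose any cell in the
finite neighbourhood of `i`. -/
theorem exists_injective_nbhd (hconn : Connected X) (hμ : UniformlyBounded μ)
    (hne : ¬ Amenable μ) {ι : Type*} {π : X → ι} {c : ℝ} (h : Cells μ π c) (K : ℕ) :
    ∃ R : Set (X × X), IsControlled R ∧ ∃ g : ι × Fin K → ι, Function.Injective g ∧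
      ∀ i k, g (i, k) ∈ nbhd π R i := by
  classical
  obtain ⟨C, hC⟩ := h.exists_measure_le hμ
  -- Expansion of measure by `M` with `M c > K C` yields expansion of the number of cells by `K`,
  -- because a cell has measure between `c` and `C`.
  obtain ⟨M, hM⟩ := ENNReal.exists_nat_mul_gt (ENNReal.ofReal_pos.2 h.pos).ne'
    (ENNReal.mul_ne_top (ENNReal.natCast_ne_top K) (ENNReal.coe_ne_top (r := C)))
  obtain ⟨R, hR, hRm, hRU⟩ := exists_expanding hne M
  have hfin : ∀ i, (nbhd π R i).Finite := fun i => by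
    refine h.finite_of_bounded hμ ?_
    rw [nbhd, preimage_image_eq_thicken]
    exact ((h.bounded i).thicken hR).thicken h.controlled
  have hcard : ∀ s : Finset ι, K * s.card ≤ (s.biUnion fun i => (hfin i).toFinset).card := by
    intro s
    rcases s.eq_empty_or_nonempty with rfl | hs
    · simp
    by_contra hlt
    rw [not_le] at hlt
    obtain ⟨i, hi⟩ := hs
    have h1 := hRU (π ⁻¹' (s : Set ι))
      ((h.nonempty i).mono (preimage_mono (by simpa using hi))) (h.bounded_finset hconn s)
      (h.measurableSet _)
    have h2 : thicken R (π ⁻¹' (s : Set ι)) ⊆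
        π ⁻¹' ((s.biUnion fun i => (hfin i).toFinset : Finset ι) : Set ι) := by
      rintro y ⟨x, hx, hyx⟩
      simp only [mem_preimage, Finset.coe_biUnion, Finite.coe_toFinset, mem_iUnion]
      exact ⟨π x, hx, y, ⟨x, rfl, hyx⟩, rfl⟩
    have h3 : (M : ℝ≥0∞) * (s.card * ENNReal.ofReal c) ≤
        (s.biUnion fun i => (hfin i).toFinset).card * C :=
      ((mul_le_mul_right (h.card_le_measure s) _).trans h1).trans
        ((measure_mono h2).trans (h.measure_le_card hC _))
    have h4 : ((s.biUnion fun i => (hfin i).toFinset).card : ℝ≥0∞) * C ≤ (K * s.card : ℕ) * C := by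
      gcongr
    have h5 : (s.card : ℝ≥0∞) * (K * C) < s.card * (M * ENNReal.ofReal c) := by
      refine ENNReal.mul_lt_mul_right ?_ (ENNReal.natCast_ne_top _) hM
      exact_mod_cast (Finset.card_pos.2 ⟨i, hi⟩).ne'
    refine absurd (h3.trans h4) (not_le.2 ?_)
    calc ((K * s.card : ℕ) : ℝ≥0∞) * C = s.card * (K * C) := by
          push_cast
          ring
      _ < s.card * (M * ENNReal.ofReal c) := h5
      _ = M * (s.card * ENNReal.ofReal c) := by ring
  obtain ⟨g, hg, hgm⟩ := (Finset.all_card_le_biUnion_card_iff_exists_injective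
    fun p : ι × Fin K => (hfin p.1).toFinset).1 (by
      intro s
      -- A set of copies has at most `K` times as many elements as its projection to the cells,
      -- which gives Hall's condition.
      have h1 : s ⊆ s.image Prod.fst ×ˢ Finset.univ := by
        intro p hp
        simp only [Finset.mem_product, Finset.mem_image, Finset.mem_univ, and_true]
        exact ⟨p, hp, rfl⟩
      have h2 := Finset.card_le_card h1
      rw [Finset.card_product, Finset.card_univ, Fintype.card_fin, mul_comm] at h2
      refine (h2.trans (hcard _)).trans (Finset.card_le_card ?_)
      intro j hj
      simp only [Finset.mem_biUnion, Finset.mem_image] at hj ⊢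
      obtain ⟨_, ⟨p, hp, rfl⟩, hj⟩ := hj
      exact ⟨p, hp, hj⟩)
  exact ⟨R, hR, g, hg, fun i k => (hfin i).mem_toFinset.1 (hgm (i, k))⟩

/-- Take a maximal set `A` within which `f` only fixes points. Colour `A` by `0`, the other points
that `f` sends into `A` by `1`, and the rest by `2`. By maximality a point of colour `2` lies in
`f(A)`, so by injectivity its predecessor is in `A`. -/
theorem exists_three_coloring {ι : Type*} {f : ι → ι} (hf : Function.Injective f) :
    ∃ col : ι → Fin 3, ∀ i, f i ≠ i → col (f i) ≠ col i := by
  classical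
  obtain ⟨A, hA⟩ := zorn_subset {A : Set ι | ∀ i ∈ A, f i ∈ A → f i = i} (by
    intro s hs hchain
    refine ⟨⋃₀ s, ?_, fun t ht => subset_sUnion_of_mem ht⟩
    rintro i ⟨t, ht, hit⟩ ⟨t', ht', hit'⟩
    rcases hchain.total ht ht' with h | h
    · exact hs ht' i (h hit) hit'
    · exact hs ht i hit (h hit'))
  have hmax : ∀ i, i ∉ A → f i ∈ A ∨ ∃ j ∈ A, f j = i := by
    intro i hi
    by_contra hcon
    push Not at hcon
    refine hi (hA.le_of_ge (y := insert i A) ?_ (subset_insert i A) (mem_insert i A))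
    rintro j (rfl | hj) (h | h)
    · exact h
    · exact absurd h hcon.1
    · exact absurd h (hcon.2 j hj)
    · exact hA.prop j hj h
  refine ⟨fun i => if i ∈ A then 0 else if f i ∈ A then 1 else 2, fun i hi => ?_⟩
  by_cases h0 : i ∈ A
  · have h1 : f i ∉ A := fun h => hi (hA.prop i h0 h)
    simp only [h0, h1, if_true, if_false]
    split_ifs <;> decide
  · by_cases h1 : f i ∈ A
    · simp [h0, h1]
    · by_cases h2 : f (f i) ∈ A
      · simp [h0, h1, h2]
      · obtain ⟨j, hj, hji⟩ := (hmax (f i) h1).resolve_left h2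
        exact absurd (hf hji ▸ hj) h0

end Expansion

/-! ### The finitely additive mass of a vector on sets of cells. -/

section Mass

variable {X : Type u} [MeasurableSpace X] [CoarseSpace X] {μ : Measure X} {ι : Type*} {π : X → ι}
  {c : ℝ} {H : Type*} [NormedAddCommGroup H] [InnerProductSpace ℂ H] [CompleteSpace H]
  (ρ : controlledAlgebra μ →⋆ₐ[ℂ] (H →L[ℂ] H)) (v : H)

variable (π) in
/-- The mass that the vector `v` gives to the cells in `J`. -/
noncomputable def mass (J : Set ι) : ℝ := ‖ρ (mulFn μ ((π ⁻¹' J).indicator 1)) v‖ ^ 2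

theorem mass_nonneg (J : Set ι) : 0 ≤ mass π ρ v J := sq_nonneg _

/-- Indicators are projections, so the mass is linear in the indicator; additivity on disjoint sets
follows. -/
theorem mass_eq (h : Cells μ π c) (J : Set ι) : mass π ρ v J =
    RCLike.re (inner ℂ v (ρ (mulFn μ ((π ⁻¹' J).indicator 1)) v)) := by
  have hJ := h.measurableSet J
  rw [mass, norm_sq_representation, star_mulFn (bddMeasurable_indicator hJ),
    mulFn_indicator_mul hJ hJ, inter_self]

theorem mass_union (h : Cells μ π c) {I J : Set ι} (hIJ : Disjoint I J) :
    mass π ρ v (I ∪ J) = mass π ρ v I + mass π ρ v J := by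
  rw [mass_eq ρ v h, mass_eq ρ v h, mass_eq ρ v h, ← map_add, ← inner_add_right,
    ← representation_add, mulFn_add (bddMeasurable_indicator (h.measurableSet I))
      (bddMeasurable_indicator (h.measurableSet J)), preimage_union,
    indicator_union_of_disjoint (hIJ.preimage π)]
  rfl

theorem mass_empty (h : Cells μ π c) : mass π ρ v ∅ = 0 := by
  have := mass_union ρ v h (disjoint_empty (∅ : Set ι))
  rw [empty_union] at this
  linarith

theorem mass_univ : mass π ρ v univ = ‖v‖ ^ 2 := by
  have h := mulFn_const (μ := μ) (1 : ℝ)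
  rw [Complex.ofReal_one, one_smul] at h
  rw [mass, preimage_univ, indicator_univ]
  change ‖ρ (mulFn μ fun _ => 1) v‖ ^ 2 = _
  rw [h, representation_one]

theorem mass_iUnion (h : Cells μ π c) {τ : Type*} [Fintype τ] {J : τ → Set ι}
    (hJ : ∀ s t, s ≠ t → Disjoint (J s) (J t)) :
    mass π ρ v (⋃ t, J t) = ∑ t, mass π ρ v (J t) := by
  classical
  have key : ∀ s : Finset τ, mass π ρ v (⋃ t ∈ s, J t) = ∑ t ∈ s, mass π ρ v (J t) := by
    intro s
    induction s using Finset.induction_on with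
    | empty => simpa using mass_empty ρ v h
    | insert a s ha ih =>
      rw [Finset.set_biUnion_insert, Finset.sum_insert ha, mass_union ρ v h, ih]
      rw [disjoint_iUnion₂_right]
      intro t ht
      exact hJ a t fun hat => ha (hat ▸ ht)
  simpa using key Finset.univ

theorem mass_le_norm_sq (h : Cells μ π c) (J : Set ι) : mass π ρ v J ≤ ‖v‖ ^ 2 := by
  rw [← mass_univ ρ v (π := π), ← union_compl_self J, mass_union ρ v h disjoint_compl_right]
  linarith [mass_nonneg ρ v (π := π) Jᶜ]

end Mass

/-! ### Averaging over pairs of cells. -/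

section Pairs

variable {X : Type u} {ι : Type*} {π : X → ι} {f : ι → ι} {J : Set ι}

variable (π) in
/-- The blocks that consist of the cells `j` and `f j`. -/
def pairBlock (f : ι → ι) (J : Set ι) (j : J) : Set X := π ⁻¹' {j.1, f j.1}

theorem iUnion_pairBlock : ⋃ j, pairBlock π f J j = π ⁻¹' (J ∪ f '' J) := by
  ext x
  simp only [mem_iUnion, pairBlock, mem_preimage, mem_insert_iff, mem_singleton_iff, mem_union,
    mem_image, Subtype.exists]
  constructor
  · rintro ⟨j, hj, h | h⟩
    · exact Or.inl (h ▸ hj)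
    · exact Or.inr ⟨j, hj, h.symm⟩
  · rintro (h | ⟨j, hj, h⟩)
    · exact ⟨_, h, Or.inl rfl⟩
    · exact ⟨j, hj, Or.inr h.symm⟩

theorem blockSet_pairBlock_subset {R : Set (X × X)} (hR : ∀ i, f i ∈ nbhd π R i) :
    blockSet (range (pairBlock π f J)) ⊆ {p | π p.1 = π p.2} ∪
      ({p | π p.1 ∈ nbhd π R (π p.2)} ∪ {p | π p.2 ∈ nbhd π R (π p.1)}) := by
  rintro ⟨x, y⟩ hxy
  obtain ⟨j, hx | hx, hy | hy⟩ := mem_blockSet_range.1 hxy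
  · exact Or.inl (Eq.trans hx (Eq.symm hy))
  · refine Or.inr (Or.inr ?_)
    change π y ∈ nbhd π R (π x)
    rw [show π x = j.1 from hx, show π y = f j.1 from hy]
    exact hR _
  · refine Or.inr (Or.inl ?_)
    change π x ∈ nbhd π R (π y)
    rw [show π x = f j.1 from hx, show π y = j.1 from hy]
    exact hR _
  · exact Or.inl (Eq.trans hx (Eq.symm hy))

variable [MeasurableSpace X] {μ : Measure X}

theorem setIntegral_indicator_const {s t : Set X} (ht : MeasurableSet t)
    (hts : t ⊆ s) (a : ℝ) : ∫ x in s, t.indicator (fun _ => a) x ∂μ = μ.real t * a := by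
  rw [setIntegral_indicator ht, inter_eq_self_of_subset_right hts]
  simp

variable (μ π) in
/-- The function on the cells `f j`, for `j ∈ J`, which is the square root of the ratio of the
measures of the cells `j` and `f j`. -/
noncomputable def ratioFn (f : ι → ι) (J : Set ι) : ι → ℝ :=
  Function.extend f (J.indicator fun i => √(μ.real (π ⁻¹' {i}) / μ.real (π ⁻¹' {f i}))) 0

theorem ratioFn_apply (hf : Function.Injective f) {i : ι} (hi : i ∈ J) :
    ratioFn π μ f J (f i) = √(μ.real (π ⁻¹' {i}) / μ.real (π ⁻¹' {f i})) := by
  rw [ratioFn, hf.extend_apply, indicator_of_mem hi]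

theorem ratioFn_eq_zero (hf : Function.Injective f) {i : ι} (hi : i ∉ f '' J) :
    ratioFn π μ f J i = 0 := by
  rw [ratioFn]
  by_cases h : ∃ j, f j = i
  · obtain ⟨j, rfl⟩ := h
    rw [hf.extend_apply, indicator_of_notMem fun hj => hi ⟨j, hj, rfl⟩]
  · rw [Function.extend_apply' _ _ _ h]
    rfl

variable [CoarseSpace X] {c : ℝ}

theorem blockFamily_pairBlock (h : Cells μ π c) (hμ : UniformlyBounded μ)
    (hf : Function.Injective f) (hJ : Disjoint (f '' J) J) :
    BlockFamily μ (pairBlock π f J) := by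
  have hfJ : ∀ {i j}, i ∈ J → j ∈ J → f i ≠ j := fun hi hj hij =>
    disjoint_left.1 hJ ⟨_, hi, rfl⟩ (hij ▸ hj)
  refine ⟨fun j => h.measurableSet _, fun i j hij => ?_, fun j => ?_, fun j => ?_⟩
  · refine Disjoint.preimage π (disjoint_left.2 ?_)
    have hij' : i.1 ≠ j.1 := fun h => hij (Subtype.ext h)
    rintro x (rfl | rfl) (hx | hx)
    · exact hij' hx
    · exact hfJ j.2 i.2 hx.symm
    · exact hfJ i.2 j.2 hx
    · exact hij' (hf hx)
  · exact ((h.measure_pos j.1).trans_le (measure_mono (preimage_mono (by simp)))).ne'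
  · rw [pairBlock, insert_eq, preimage_union]
    exact (measure_union_lt_top (h.measure_ne_top hμ _).lt_top
      (h.measure_ne_top hμ _).lt_top).ne

/-- The comparison constant for measures is taken as `L ^ 2` so that the square root is at most `L`.
-/
theorem abs_ratioFn_le (h : Cells μ π c) (hμ : UniformlyBounded μ) (hf : Function.Injective f)
    {L : ℝ} (hL0 : 0 ≤ L) (hL : ∀ i j, μ.real (π ⁻¹' {i}) ≤ L ^ 2 * μ.real (π ⁻¹' {j})) (i : ι) :
    |ratioFn π μ f J i| ≤ L := by
  by_cases hi : i ∈ f '' J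
  · obtain ⟨j, hj, rfl⟩ := hi
    rw [ratioFn_apply hf hj, abs_of_nonneg (Real.sqrt_nonneg _), Real.sqrt_le_left hL0,
      div_le_iff₀ (h.pos.trans_le (h.le_real hμ _))]
    exact hL _ _
  · rw [ratioFn_eq_zero hf hi, abs_zero]
    exact hL0

theorem Cells.measurable_comp (h : Cells μ π c) (g : ι → ℝ) : Measurable fun x => g (π x) :=
  fun t _ => h.measurableSet (g ⁻¹' t)

/-- Both sides equal the measure `a` of the cell `j`: on the cell `f j`, of measure `b`, the squared
weight is `a / b`. -/
theorem integral_pairBlock (h : Cells μ π c) (hμ : UniformlyBounded μ) (hf : Function.Injective f)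
    (hJ : Disjoint (f '' J) J) (j : J) :
    ∫ x in pairBlock π f J j, (π ⁻¹' J).indicator (1 : X → ℝ) x ∂μ =
      ∫ x in pairBlock π f J j, ((fun x => ratioFn π μ f J (π x)) * fun x => ratioFn π μ f J (π x)) x
        ∂μ := by
  have hm : MeasurableSet (pairBlock π f J j) := h.measurableSet _
  have hfj : f j.1 ∉ J := fun hj => disjoint_left.1 hJ ⟨_, j.2, rfl⟩ hj
  have hjf : j.1 ∉ f '' J := fun hj => disjoint_left.1 hJ hj j.2
  have hne : f j.1 ≠ j.1 := fun hj => hfj (hj.symm ▸ j.2)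
  set a := μ.real (π ⁻¹' {j.1})
  set b := μ.real (π ⁻¹' {f j.1})
  have hb0 : 0 < b := h.pos.trans_le (h.le_real hμ _)
  have h1 : ∫ x in pairBlock π f J j, (π ⁻¹' J).indicator (1 : X → ℝ) x ∂μ = a * 1 := by
    rw [← setIntegral_indicator_const (h.measurableSet {j.1})
      (show _ ⊆ pairBlock π f J j from preimage_mono (by simp))]
    refine setIntegral_congr_fun hm ?_
    rintro x (hx | hx)
    · have hx' : x ∈ π ⁻¹' J := by rw [mem_preimage, hx]; exact j.2
      rw [indicator_of_mem hx', indicator_of_mem (show x ∈ π ⁻¹' {j.1} from hx)]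
      rfl
    · have hx : π x = f j.1 := hx
      have hx' : x ∉ π ⁻¹' J := by rw [mem_preimage, hx]; exact hfj
      have hx'' : x ∉ π ⁻¹' {j.1} := by rw [mem_preimage, hx]; exact hne
      rw [indicator_of_notMem hx', indicator_of_notMem hx'']
  have h2 : ∫ x in pairBlock π f J j, ((fun x => ratioFn π μ f J (π x)) *
      fun x => ratioFn π μ f J (π x)) x ∂μ = b * (a / b) := by
    rw [← setIntegral_indicator_const (h.measurableSet {f j.1})
      (show _ ⊆ pairBlock π f J j from preimage_mono (by simp))]
    refine setIntegral_congr_fun hm ?_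
    rintro x (hx | hx)
    · have hx : π x = j.1 := hx
      have hx'' : x ∉ π ⁻¹' {f j.1} := by rw [mem_preimage, hx]; exact hne.symm
      rw [indicator_of_notMem hx'', Pi.mul_apply, hx, ratioFn_eq_zero hf hjf, mul_zero]
    · have hx : π x = f j.1 := hx
      rw [indicator_of_mem (show x ∈ π ⁻¹' {f j.1} from hx), Pi.mul_apply, hx,
        ratioFn_apply hf j.2, Real.mul_self_sqrt (by positivity)]
  rw [h1, h2]
  field_simp

variable {H : Type*} [NormedAddCommGroup H] [InnerProductSpace ℂ H] [CompleteSpace H]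
  (ρ : controlledAlgebra μ →⋆ₐ[ℂ] (H →L[ℂ] H)) (v : H)

/-- An instance of `norm_sq_le_of_compression`: `p` averages over the pairs, `a` and `b` are the
indicators of `J` and `f '' J`, and `q` is `ratioFn`. -/
theorem mass_le_of_almost_constant [Countable ι] (h : Cells μ π c) (hμ : UniformlyBounded μ)
    (hf : Function.Injective f) (hJ : Disjoint (f '' J) J)
    (hc : IsControlled (blockSet (range (pairBlock π f J))))
    {L : ℝ} (hL1 : 1 ≤ L) (hL : ∀ i j, μ.real (π ⁻¹' {i}) ≤ L ^ 2 * μ.real (π ⁻¹' {j}))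
    {γ : ℝ} (hγ : ‖ρ (blockElem (blockFamily_pairBlock h hμ hf hJ) hc -
      mulFn μ ((⋃ j, pairBlock π f J j).indicator 1)) v‖ ≤ γ) :
    mass π ρ v J ≤ 2 * L ^ 2 * mass π ρ v (f '' J) + 8 * L ^ 2 * γ ^ 2 := by
  have hB := blockFamily_pairBlock h hμ hf hJ
  have hqm : Measurable fun x => ratioFn π μ f J (π x) := h.measurable_comp _
  have hqL : ∀ x, |ratioFn π μ f J (π x)| ≤ L := fun x =>
    abs_ratioFn_le h hμ hf (zero_le_one.trans hL1) hL (π x)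
  have hqb : BddMeasurable fun x => ratioFn π μ f J (π x) := ⟨hqm, L, hqL⟩
  have hA := h.measurableSet J
  have hB' := h.measurableSet (f '' J)
  have hS := h.measurableSet (J ∪ f '' J)
  rw [iUnion_pairBlock] at hγ
  refine norm_sq_le_of_compression ρ (star_blockElem hB hc)
    (star_mulFn (bddMeasurable_indicator hA)) (star_mulFn hqb) ?_ ?_ ?_ ?_
    (norm_representation_indicator_le ρ hA) (norm_representation_indicator_le ρ hB') hL1
    (norm_representation_mulFn_le ρ hqm hqL (zero_le_one.trans hL1)) hγ
  · rw [mulFn_indicator_mul hA hA, inter_self, mulFn_mul hqb hqb]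
    exact Subtype.ext (blockProj_mul_mulOp_mul hB (bddMeasurable_indicator hA)
      (hqb.mul hqb) (integral_pairBlock h hμ hf hJ))
  · rw [mulFn_mul hqb (bddMeasurable_indicator hB')]
    congr 1
    ext x
    by_cases hx : x ∈ π ⁻¹' (f '' J)
    · simp only [Pi.mul_apply, indicator_of_mem hx, Pi.one_apply, mul_one]
    · rw [Pi.mul_apply, indicator_of_notMem hx, mul_zero, ratioFn_eq_zero hf hx]
  · rw [mulFn_indicator_mul hA hS, inter_eq_self_of_subset_left (preimage_mono subset_union_left)]
  · rw [mulFn_indicator_mul hB' hS,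
      inter_eq_self_of_subset_left (preimage_mono subset_union_right)]

end Pairs

/-! ### Non-amenable spaces have property (T). -/

section NonAmenable

variable {X : Type u} [MeasurableSpace X] [CoarseSpace X] {μ : Measure X}

theorem geometricPropertyT_of_not_amenable [MeasurableSingletonClass X] (hconn : Connected X)
    (hcount : CountablyCovered X) (hμ : UniformlyBounded μ) (hg : ∃ E, Gordo μ E)
    (hne : ¬ Amenable μ) : GeometricPropertyT μ := by
  classical
  obtain ⟨ι, _, π, c, h⟩ := exists_cells hcount hμ hg
  obtain ⟨C, hC⟩ := h.exists_measure_le hμ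
  have hc := h.pos
  set L : ℝ := C / c + 1
  have hCc : 0 ≤ (C : ℝ) / c := by positivity
  have hL1 : 1 ≤ L := by linarith
  have hL : ∀ i j, μ.real (π ⁻¹' {i}) ≤ L ^ 2 * μ.real (π ⁻¹' {j}) := by
    intro i j
    have h1 : μ.real (π ⁻¹' {i}) ≤ C := ENNReal.toReal_le_coe_of_le_coe (hC i)
    have h2 := h.le_real hμ j
    calc μ.real (π ⁻¹' {i}) ≤ C := h1
      _ = C / c * c := by field_simp
      _ ≤ L ^ 2 * μ.real (π ⁻¹' {j}) := by
        gcongr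
        nlinarith
  -- Summing the mass estimates over `K` disjoint ranges will give `K / 2 ≤ 2 * L ^ 2`.
  obtain ⟨K, hK⟩ := exists_nat_gt (4 * L ^ 2)
  obtain ⟨R, hR, g, hg, hgR⟩ := exists_injective_nbhd hconn hμ hne h K
  set E : Set (X × X) := {p | π p.1 = π p.2} ∪
    ({p | π p.1 ∈ nbhd π R (π p.2)} ∪ {p | π p.2 ∈ nbhd π R (π p.1)}) with hEdef
  have hE : IsControlled E := union h.controlled
    (union (isControlled_nbhd h hR) (inv (isControlled_nbhd h hR)))
  -- The value `γ = 1 / (8 * L)` makes the error term `8 * L ^ 2 * γ ^ 2` equal to `1 / 8`.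
  refine ⟨E, c, 1 / (8 * L), hE, hc, by positivity, ?_⟩
  intro H _ _ _ ρ v _ hv1
  by_contra hcon
  push Not at hcon
  have step : ∀ f : ι → ι, Function.Injective f → (∀ i, f i ∈ nbhd π R i) → ∀ J : Set ι,
      Disjoint (f '' J) J → mass π ρ v J ≤ 2 * L ^ 2 * mass π ρ v (f '' J) + 1 / 8 := by
    intro f hf hfR J hJ
    -- For empty `J` the block operator is zero, and the negated property (T) says nothing about it.
    rcases J.eq_empty_or_nonempty with rfl | hJne
    · rw [image_empty, mass_empty ρ v h]
      norm_num
    have : Nonempty J := hJne.to_subtype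
    have hsub : blockSet (range (pairBlock π f J)) ⊆ E := blockSet_pairBlock_subset hfR
    have hcB := CoarseSpace.mono hE hsub
    set hB := blockFamily_pairBlock h hμ hf hJ
    have h1 := hcon (blockElem hB hcB) _ (blockElem_ne_zero hB hcB)
      (inBlocks_blockElem hB hcB hsub fun j => (h.le_measure j.1).trans
        (measure_mono (preimage_mono (by simp)))) (isPhi_blockElem hμ hB hcB)
    have h2 := mass_le_of_almost_constant ρ v h hμ hf hJ hcB hL1 hL (γ := 1 / (8 * L))
      (h1.le.trans (mul_le_of_le_one_right (by positivity) norm_blockProj_le))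
    have h3 : 8 * L ^ 2 * (1 / (8 * L)) ^ 2 = 1 / 8 := by
      field_simp
    rwa [h3] at h2
  have step2 : ∀ f : ι → ι, Function.Injective f → (∀ i, f i ∈ nbhd π R i) →
      1 ≤ 2 * L ^ 2 * mass π ρ v (range f) + 1 / 2 := by
    intro f hf hfR
    obtain ⟨col, hcol⟩ := exists_three_coloring hf
    -- Four classes: the fixed points of `f` (`none`), for which the estimate is trivial, and three
    -- colours, on each of which `f` leaves the class. The four errors `1 / 8` add up to `1 / 2`.
    let J : Option (Fin 3) → Set ι := fun o =>
      {i | (if f i = i then none else some (col i)) = o}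
    have hJd : ∀ s t, s ≠ t → Disjoint (J s) (J t) := fun s t hst =>
      disjoint_left.2 fun i his hit => hst (Eq.trans (Eq.symm his) hit)
    have hJu : ⋃ t, J t = univ := eq_univ_of_forall fun i => mem_iUnion.2 ⟨_, rfl⟩
    have h1 : ∑ t, mass π ρ v (J t) = 1 := by
      rw [← mass_iUnion ρ v h hJd, hJu, mass_univ, hv1, one_pow]
    have h2 : ∑ t, mass π ρ v (f '' J t) = mass π ρ v (range f) := by
      rw [← mass_iUnion ρ v h fun s t hst => (disjoint_image_iff hf).2 (hJd s t hst),
        ← image_iUnion, hJu, image_univ]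
    have h3 : ∀ t, mass π ρ v (J t) ≤ 2 * L ^ 2 * mass π ρ v (f '' J t) + 1 / 8 := by
      intro t
      rcases t with _ | m
      · have hfix : f '' J none = J none := by
          have : ∀ i ∈ J none, f i = i := by
            intro i hi
            by_contra hfi
            simp [J, hfi] at hi
          rw [image_congr this, image_id']
        rw [hfix]
        have hm := mass_nonneg ρ v (π := π) (J none)
        have hL2 : 1 ≤ 2 * L ^ 2 := by nlinarith
        linarith [le_mul_of_one_le_left hm hL2]
      · refine step f hf hfR _ (disjoint_left.2 ?_)
        rintro _ ⟨i, hi, rfl⟩ hfi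
        have hi' : ∀ i ∈ J (some m), f i ≠ i ∧ col i = m := by
          intro i hi
          by_cases hfi : f i = i
          · simp [J, hfi] at hi
          · exact ⟨hfi, by simpa [J, hfi] using hi⟩
        exact hcol i (hi' i hi).1 ((hi' _ hfi).2.trans (hi' i hi).2.symm)
    have h4 := Finset.sum_le_sum fun t (_ : t ∈ Finset.univ) => h3 t
    rw [h1, Finset.sum_add_distrib, ← Finset.mul_sum, h2] at h4
    simp only [Finset.sum_const, Finset.card_univ, Fintype.card_option, Fintype.card_fin] at h4
    norm_num at h4 ⊢
    linarith
  have hsum : ∑ k : Fin K, mass π ρ v (range fun i => g (i, k)) ≤ 1 := by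
    rw [← mass_iUnion ρ v h, ← one_pow 2, ← hv1]
    · exact mass_le_norm_sq ρ v h _
    · intro s t hst
      refine disjoint_left.2 ?_
      rintro _ ⟨i, rfl⟩ ⟨j, hj⟩
      exact hst (congrArg Prod.snd (hg hj)).symm
  have hall : ∀ k ∈ (Finset.univ : Finset (Fin K)),
      (1 : ℝ) ≤ 2 * L ^ 2 * mass π ρ v (range fun i => g (i, k)) + 1 / 2 := fun k _ =>
    step2 _ (fun i j hij => congrArg Prod.fst (hg hij)) fun i => hgR i k
  have h4 := Finset.sum_le_sum hall
  rw [Finset.sum_add_distrib, ← Finset.mul_sum] at h4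
  simp only [Finset.sum_const, Finset.card_univ, Fintype.card_fin, nsmul_eq_mul] at h4
  nlinarith

end NonAmenable

/-! ### Blocks crossing a boundary and support lemmas. -/

section SplitBlocks

variable {X : Type u}

/-- The union of the blocks that meet both `W` and its complement. -/
def splitBlocks (𝒜 : Set (Set X)) (W : Set X) : Set X :=
  ⋃ A ∈ {A ∈ 𝒜 | (A ∩ W).Nonempty ∧ (A \ W).Nonempty}, A

theorem mem_splitBlocks {𝒜 : Set (Set X)} {W : Set X} {x : X} : x ∈ splitBlocks 𝒜 W ↔
    ∃ A ∈ 𝒜, ((A ∩ W).Nonempty ∧ (A \ W).Nonempty) ∧ x ∈ A := by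
  simp only [splitBlocks, mem_iUnion, mem_ofPred_eq, exists_prop, and_assoc]

theorem mem_blockSet {𝒜 : Set (Set X)} {x y : X} :
    (x, y) ∈ blockSet 𝒜 ↔ ∃ A ∈ 𝒜, x ∈ A ∧ y ∈ A := by
  simp only [blockSet, mem_iUnion, mem_prod, exists_prop]

end SplitBlocks

section SupportLemmas

variable {X : Type u} [MeasurableSpace X] {μ : Measure X}

theorem inner_eq_zero_of_vanishesOff {ξ η : Lp ℂ 2 μ} {A B : Set X} (hξ : VanishesOff ξ A)
    (hη : VanishesOff η B) (h : Disjoint A B) : inner ℂ ξ η = 0 := by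
  rw [L2.inner_def]
  apply integral_eq_zero_of_ae
  filter_upwards [hξ, hη] with x h1 h2
  by_cases hx : x ∈ A
  · simp [h2 fun hxB => disjoint_left.1 h hx hxB]
  · simp [h1 hx]

theorem vanishesOff_mulOp_indicator {A B : Set X} (hA : MeasurableSet A) {ξ : Lp ℂ 2 μ}
    (hξ : VanishesOff ξ B) : VanishesOff (mulOp (linf μ (A.indicator 1)) ξ) (A ∩ B) := by
  filter_upwards [hξ, coeFn_mulOp_linf (bddMeasurable_indicator hA) ξ] with x h1 h2 hx
  rw [h2]
  by_cases hxA : x ∈ A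
  · rw [h1 fun hxB => hx ⟨hxA, hxB⟩, mul_zero]
  · simp [hxA]

theorem vanishesOff_l2ind {A : Set X} (hA : MeasurableSet A) (hμA : μ A ≠ ⊤) :
    VanishesOff (l2ind μ A) A := by
  filter_upwards [coeFn_l2ind hA hμA] with x h1 hx
  rw [h1, indicator_of_notMem hx]

theorem mulOp_indicator_add_compl {A : Set X} (hA : MeasurableSet A) (ξ : Lp ℂ 2 μ) :
    mulOp (linf μ (A.indicator 1)) ξ + mulOp (linf μ (Aᶜ.indicator 1)) ξ = ξ := by
  apply Lp.ext
  filter_upwards [coeFn_mulOp_linf (bddMeasurable_indicator hA) ξ,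
    coeFn_mulOp_linf (bddMeasurable_indicator hA.compl) ξ,
    Lp.coeFn_add (mulOp (linf μ (A.indicator 1)) ξ) (mulOp (linf μ (Aᶜ.indicator 1)) ξ)]
    with x h1 h2 h3
  rw [h3, Pi.add_apply, h1, h2]
  by_cases hx : x ∈ A <;> simp [hx]

theorem mulOp_indicator_mulOp_indicator {A B : Set X} (hA : MeasurableSet A) (hB : MeasurableSet B)
    (ξ : Lp ℂ 2 μ) : mulOp (linf μ (A.indicator 1)) (mulOp (linf μ (B.indicator 1)) ξ) =
      mulOp (linf μ ((A ∩ B).indicator 1)) ξ := by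
  apply Lp.ext
  filter_upwards [coeFn_mulOp_linf (bddMeasurable_indicator hA) (mulOp (linf μ (B.indicator 1)) ξ),
    coeFn_mulOp_linf (bddMeasurable_indicator hB) ξ,
    coeFn_mulOp_linf (bddMeasurable_indicator (hA.inter hB)) ξ] with x h1 h2 h3
  rw [h1, h2, h3]
  by_cases hxA : x ∈ A <;> by_cases hxB : x ∈ B <;> simp [hxA, hxB]

theorem inner_mulOp_l2ind_eq_zero (f : Lp ℂ ∞ μ) {A B : Set X} (hA : MeasurableSet A)
    (hμA : μ A ≠ ⊤) {ξ : Lp ℂ 2 μ} (hξ : VanishesOff ξ B) (h : Disjoint B A) :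
    inner ℂ ξ (mulOp f (l2ind μ A)) = 0 := by
  refine inner_eq_zero_of_vanishesOff hξ (B := A) ?_ h
  filter_upwards [coeFn_mulOp f (l2ind μ A), vanishesOff_l2ind hA hμA] with x h1 h2 hx
  rw [h1, h2 hx, mul_zero]

/-- A σ-finite measure admits only countably many disjoint measurable sets of positive measure. This
makes unions of blocks measurable. -/
theorem IsBlocking.countable [SigmaFinite μ] {E : Set (X × X)} {ε : ℝ} (hε : 0 < ε)
    {𝒜 : Set (Set X)} (h : IsBlocking μ E ε 𝒜) : 𝒜.Countable := by
  have := Measure.countable_meas_pos_of_disjoint_iUnion (μ := μ) (As := fun A : 𝒜 => A.1)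
    (fun A => h.measurableSet A.1 A.2)
    (fun A B hAB => h.disjoint A.1 A.2 B.1 B.2 fun h' => hAB (Subtype.ext h'))
  have huniv : {A : 𝒜 | 0 < μ A.1} = univ := eq_univ_of_forall fun A =>
    (ENNReal.ofReal_pos.2 hε).trans_le (h.le_measure A.1 A.2)
  rw [huniv, countable_univ_iff] at this
  exact countable_coe_iff.1 this

variable [CoarseSpace X]

theorem norm_mulOp_indicator_le {A : Set X} (hA : MeasurableSet A) (ξ : Lp ℂ 2 μ) :
    ‖mulOp (linf μ (A.indicator 1)) ξ‖ ≤ ‖ξ‖ :=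
  norm_representation_indicator_le (controlledAlgebra μ).subtype hA ξ

end SupportLemmas

/-! ### Følner sets made of cells, and constant vectors in `L²`. -/

section Folner

variable {X : Type u} [MeasurableSpace X] {μ : Measure X} [CoarseSpace X]

/-- Off `D` the relation `R` does not cross the boundary of `W`, so the error `u` lives on `D`.
Pairing `u` with itself reduces everything to `T` acting on indicators inside `D`. Only `‖T‖` enters
the bound, not the sup norm of `f`. -/
theorem norm_sub_mulOp_le {T : controlledAlgebra μ} {f : Lp ℂ ∞ μ} (hT : IsPhi T f)
    {R : Set (X × X)} (hR : MeasurableRel R) (hTR : SupportedOn R T.1) {W D : Set X}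
    (hW : MeasurableSet W) (hWb : Bounded W) (hWf : μ W ≠ ⊤) (hD : MeasurableSet D)
    (hDf : μ D ≠ ⊤) (h1 : thicken R (W \ D) ⊆ W) (h2 : Disjoint (thicken R (Wᶜ \ D)) W)
    (h3 : thicken R D ⊆ D) :
    ‖T.1 (l2ind μ W) - mulOp f (l2ind μ W)‖ ≤ 2 * ‖T.1‖ * √(μ.real D) := by
  rw [supportedOn_iff hR] at hTR
  set u := T.1 (l2ind μ W) - mulOp f (l2ind μ W) with hu
  have hadj : ∀ ξ η : Lp ℂ 2 μ, inner ℂ ξ (T.1 η) = inner ℂ (star T.1 ξ) η := fun ξ η => by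
    rw [ContinuousLinearMap.star_eq_adjoint, ContinuousLinearMap.adjoint_inner_left]
  have huD : VanishesOff u D := by
    -- Test vectors off `D` are split along `W`: inside `W` the operator sees the indicator of `W`
    -- as the constant `1`; outside, both terms vanish.
    refine vanishesOff_of_inner hD fun ζ hζ => ?_
    have hζD : VanishesOff ζ Dᶜ := by
      filter_upwards [hζ] with x hx hxD
      rw [hx, indicator_of_notMem hxD]
    have e1 : VanishesOff (mulOp (linf μ (W.indicator 1)) ζ) (W \ D) :=
      vanishesOff_mulOp_indicator hW hζD
    have e2 : VanishesOff (mulOp (linf μ (Wᶜ.indicator 1)) ζ) (Wᶜ \ D) :=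
      vanishesOff_mulOp_indicator hW.compl hζD
    rw [← mulOp_indicator_add_compl hW ζ, inner_add_left, hu, inner_sub_right, inner_sub_right,
      hT.inner_l2ind (hWb.mono sdiff_subset) (hW.diff hD) e1 hW hWf
        ((hTR _ (hW.diff hD) _ e1).mono h1) hW hWf sdiff_subset, sub_self, zero_add,
      inner_mulOp_l2ind_eq_zero f hW hWf e2 (disjoint_left.2 fun x hx => hx.1), sub_zero, hadj]
    exact inner_eq_zero_of_vanishesOff (hTR _ (hW.compl.diff hD) _ e2)
      (vanishesOff_l2ind hW hWf) h2
  have hn : ‖l2ind μ D‖ = √(μ.real D) := by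
    rw [← norm_sq_l2ind hD hDf, Real.sqrt_sq (norm_nonneg _)]
  have e1 : inner ℂ u (T.1 (l2ind μ W)) =
      inner ℂ u (T.1 (mulOp (linf μ (W.indicator 1)) (l2ind μ D))) := by
    rw [hadj, hadj, mulOp_indicator_l2ind hW hD hDf]
    apply inner_eq_of_ae
    filter_upwards [(hTR _ hD _ huD).mono h3, coeFn_l2ind hW hWf,
      coeFn_l2ind (hW.inter hD) (ne_top_of_le_ne_top hDf (measure_mono inter_subset_right))]
      with x g1 g2 g3
    by_cases hx : x ∈ D
    · rw [g2, g3]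
      by_cases hxW : x ∈ W <;> simp [hx, hxW]
    · simp [g1 hx]
  -- The defining identity of `Φ(T)` trades `f` back for `T`, now applied to the indicator of the
  -- `R`-invariant set `D`.
  have e2 : inner ℂ u (mulOp f (l2ind μ W)) =
      inner ℂ (mulOp (linf μ (W.indicator 1)) u) (T.1 (l2ind μ D)) := by
    have g1 := vanishesOff_mulOp_indicator hW huD
    have g2 := vanishesOff_mulOp_indicator hW.compl huD
    rw [hT.inner_l2ind (hWb.mono inter_subset_left) (hW.inter hD) g1 hD hDf
      ((hTR _ hD _ (g1.mono inter_subset_right)).mono h3) hW hWf inter_subset_left]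
    conv_lhs => rw [← mulOp_indicator_add_compl hW u]
    rw [inner_add_left, inner_mulOp_l2ind_eq_zero f hW hWf g2
      (disjoint_left.2 fun x hx => hx.1), add_zero]
  have b1 : ‖inner ℂ u (T.1 (l2ind μ W))‖ ≤ ‖u‖ * (‖T.1‖ * √(μ.real D)) := by
    rw [e1, ← hn]
    refine (norm_inner_le_norm _ _).trans ?_
    gcongr
    exact (T.1.le_opNorm _).trans (by gcongr; exact norm_mulOp_indicator_le hW _)
  have b2 : ‖inner ℂ u (mulOp f (l2ind μ W))‖ ≤ ‖u‖ * (‖T.1‖ * √(μ.real D)) := by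
    rw [e2, ← hn]
    refine (norm_inner_le_norm _ _).trans ?_
    gcongr
    · exact norm_mulOp_indicator_le hW _
    · exact T.1.le_opNorm _
  have b3 : ‖u‖ * ‖u‖ ≤ ‖u‖ * (2 * ‖T.1‖ * √(μ.real D)) := by
    have g := norm_sub_le (inner ℂ u (T.1 (l2ind μ W))) (inner ℂ u (mulOp f (l2ind μ W)))
    rw [← inner_sub_right, ← hu, inner_self_eq_norm_sq_to_K] at g
    simp only [norm_pow, RCLike.norm_ofReal, abs_norm] at g
    linarith
  rcases (norm_nonneg u).eq_or_lt with h0 | h0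
  · rw [← h0]
    positivity
  · exact le_of_mul_le_mul_left b3 h0

theorem norm_sub_mulOp_le_splitBlocks {T : controlledAlgebra μ} {f : Lp ℂ ∞ μ} (hT : IsPhi T f)
    {𝒜 : Set (Set X)} (hc : 𝒜.Countable) (hm : ∀ A ∈ 𝒜, MeasurableSet A)
    (hd : ∀ A ∈ 𝒜, ∀ B ∈ 𝒜, A ≠ B → Disjoint A B) (hTR : SupportedOn (blockSet 𝒜) T.1) {W : Set X}
    (hW : MeasurableSet W) (hWb : Bounded W) (hWf : μ W ≠ ⊤) (hDf : μ (splitBlocks 𝒜 W) ≠ ⊤) :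
    ‖T.1 (l2ind μ W) - mulOp f (l2ind μ W)‖ ≤ 2 * ‖T.1‖ * √(μ.real (splitBlocks 𝒜 W)) := by
  refine norm_sub_mulOp_le hT (measurableRel_blockSet hc hm) hTR hW hWb hWf
    (MeasurableSet.biUnion (hc.mono fun A hA => hA.1) fun A hA => hm A hA.1) hDf ?_ ?_ ?_
  · rintro y ⟨x, ⟨hxW, hxD⟩, hyx⟩
    obtain ⟨A, hA, hy, hx⟩ := mem_blockSet.1 hyx
    by_contra hyW
    exact hxD (mem_splitBlocks.2 ⟨A, hA, ⟨⟨x, hx, hxW⟩, y, hy, hyW⟩, hx⟩)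
  · refine disjoint_left.2 ?_
    rintro y ⟨x, ⟨hxW, hxD⟩, hyx⟩ hyW
    obtain ⟨A, hA, hy, hx⟩ := mem_blockSet.1 hyx
    exact hxD (mem_splitBlocks.2 ⟨A, hA, ⟨⟨y, hy, hyW⟩, x, hx, hxW⟩, hx⟩)
  · rintro y ⟨x, hxD, hyx⟩
    obtain ⟨A, hA, hy, hx⟩ := mem_blockSet.1 hyx
    obtain ⟨B, hB, hBs, hxB⟩ := mem_splitBlocks.1 hxD
    obtain rfl : A = B := by
      by_contra hAB
      exact disjoint_left.1 (hd A hA B hB hAB) hx hxB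
    exact mem_splitBlocks.2 ⟨A, hA, hBs, hy⟩

variable {ι : Type*} [Countable ι] {π : X → ι} {c : ℝ}

theorem Cells.sigmaFinite (h : Cells μ π c) (hμ : UniformlyBounded μ) : SigmaFinite μ := by
  refine Measure.sigmaFinite_of_countable (S := range fun i => π ⁻¹' {i}) (countable_range _) ?_ ?_
  · rintro _ ⟨i, rfl⟩
    exact (h.measure_ne_top hμ i).lt_top
  · exact eq_univ_of_forall fun x => mem_sUnion.2 ⟨_, ⟨π x, rfl⟩, rfl⟩

/-- Thickened cells have measure at most some `C`, which is at most `C / c` times the measure of a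
cell. Small sets in general satisfy no such bound, so only unions of cells are considered. -/
theorem Cells.exists_measure_thicken_le (h : Cells μ π c) (hμ : UniformlyBounded μ)
    {E : Set (X × X)} (hE : IsControlled E) (hEm : MeasurableRel E) :
    ∃ k : NNReal, ∀ J : Set ι, μ (thicken E (π ⁻¹' J)) ≤ k * μ (π ⁻¹' J) := by
  obtain ⟨C, hC⟩ := hμ _ (comp (comp hE h.controlled) (inv hE))
  have hc := ENNReal.ofReal_pos.2 h.pos
  have hcell : ∀ i, μ (thicken E (π ⁻¹' {i})) ≤ C := by
    intro i
    refine hC _ (hEm _ (h.measurableSet _)) ?_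
    rintro ⟨x, y⟩ ⟨⟨a, ha, hxa⟩, ⟨b, hb, hyb⟩⟩
    exact ⟨b, ⟨a, hxa, Eq.trans ha (Eq.symm hb)⟩, hyb⟩
  refine ⟨C / c.toNNReal, fun J => ?_⟩
  have hk : ((C / c.toNNReal : NNReal) : ℝ≥0∞) * ENNReal.ofReal c = C := by
    rw [ENNReal.ofReal, ← ENNReal.coe_mul, div_mul_cancel₀]
    exact (Real.toNNReal_pos.2 h.pos).ne'
  have hJ : π ⁻¹' J = ⋃ i ∈ J, π ⁻¹' {i} := (biUnion_preimage_singleton π J).symm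
  have hthick : thicken E (π ⁻¹' J) ⊆ ⋃ i ∈ J, thicken E (π ⁻¹' {i}) := by
    rintro y ⟨x, hx, hyx⟩
    exact mem_biUnion hx ⟨x, rfl, hyx⟩
  calc μ (thicken E (π ⁻¹' J)) ≤ μ (⋃ i ∈ J, thicken E (π ⁻¹' {i})) := measure_mono hthick
    _ ≤ ∑' i : J, μ (thicken E (π ⁻¹' {i.1})) := measure_biUnion_le μ (to_countable J) _
    _ ≤ ∑' i : J, ((C / c.toNNReal : NNReal) : ℝ≥0∞) * μ (π ⁻¹' {i.1}) := by
      refine ENNReal.tsum_le_tsum fun i => (hcell i.1).trans ?_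
      rw [← hk]
      gcongr
      exact h.le_measure i.1
    _ = _ := by
      rw [ENNReal.tsum_mul_left, hJ, measure_biUnion (to_countable J) _ fun i _ => h.measurableSet _]
      intro i _ j _ hij
      exact Disjoint.preimage π (by simpa using hij)

/-- Replacing a Følner set `U` by the union `W` of the cells it meets makes the boundary consist of
whole cells. A block split by `W` contains a point whose entire cell lies in `E'_U \ U`, so the
split blocks lie in a thickening of such cells. -/
theorem exists_folner_cells [MeasurableSingletonClass X] (hcount : CountablyCovered X)
    (hμ : UniformlyBounded μ) (hg : ∃ F, Gordo μ F) (ham : Amenable μ) (h : Cells μ π c)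
    {E : Set (X × X)} (hE : IsControlled E) {δ : ℝ} (hδ : 0 < δ) :
    ∃ W : Set X, W.Nonempty ∧ Bounded W ∧ (∃ J, W = π ⁻¹' J) ∧
      ∀ 𝒜 : Set (Set X), blockSet 𝒜 ⊆ E → μ (splitBlocks 𝒜 W) ≤ ENNReal.ofReal δ * μ W := by
  -- The cell relation on both sides allows moves within a cell before and after `E`; the diagonal
  -- ensures `U ⊆ E'_U`.
  obtain ⟨E', hEE', hE', -, hE'm⟩ := exists_symmetric_measurable_superset hcount hμ hg
    (comp (comp h.controlled (union hE diagonal)) h.controlled)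
  have hsub : ∀ x y z w, π x = π y → (y, z) ∈ E ∨ y = z → π z = π w → (x, w) ∈ E' :=
    fun x y z w h1 h2 h3 => hEE' ⟨z, ⟨y, h1, h2⟩, h3⟩
  obtain ⟨k, hk⟩ := h.exists_measure_thicken_le hμ hE' hE'm
  obtain ⟨U, hUne, hUb, hUm, hU⟩ := ham E' hE' hE'm (δ / (k + 1)) (by positivity)
  have hWb : Bounded (π ⁻¹' (π '' U)) := by
    rw [preimage_image_eq_thicken]
    exact hUb.thicken h.controlled
  refine ⟨π ⁻¹' (π '' U), hUne.mono (subset_preimage_image π U), hWb, ⟨_, rfl⟩, fun 𝒜 h𝒜 => ?_⟩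
  set J : Set ι := {j | π ⁻¹' {j} ⊆ thicken E' U \ U}
  have hsplit : splitBlocks 𝒜 (π ⁻¹' (π '' U)) ⊆ thicken E' (π ⁻¹' J) := by
    intro z hz
    obtain ⟨A, hA, ⟨⟨x, hxA, u, hu, hux⟩, ⟨y, hyA, hyU⟩⟩, hzA⟩ := mem_splitBlocks.1 hz
    have hAE : ∀ a ∈ A, ∀ b ∈ A, (a, b) ∈ E := fun a ha b hb =>
      h𝒜 (mem_blockSet.2 ⟨A, hA, ha, hb⟩)
    refine ⟨y, fun w hw => ⟨⟨u, hu, hsub w y x u hw (Or.inl (hAE y hyA x hxA)) hux.symm⟩, ?_⟩,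
      hsub z z y y rfl (Or.inl (hAE z hzA y hyA)) rfl⟩
    intro hwU
    exact hyU ⟨w, hwU, hw⟩
  have hUf : μ U ≠ ⊤ := hμ.measure_ne_top hUb hUm
  have hUE : U ⊆ thicken E' U := fun x hx => ⟨x, hx, hsub x x x x rfl (Or.inr rfl) rfl⟩
  have hdiff : μ (thicken E' U \ U) ≤ ENNReal.ofReal (δ / (k + 1)) * μ U := by
    rw [measure_sdiff hUE hUm.nullMeasurableSet hUf, tsub_le_iff_right]
    refine hU.trans_eq ?_
    rw [ENNReal.ofReal_add zero_le_one (by positivity), ENNReal.ofReal_one, add_mul, one_mul,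
      add_comm]
  calc μ (splitBlocks 𝒜 (π ⁻¹' (π '' U))) ≤ μ (thicken E' (π ⁻¹' J)) := measure_mono hsplit
    _ ≤ k * μ (π ⁻¹' J) := hk J
    _ ≤ k * (ENNReal.ofReal (δ / (k + 1)) * μ U) := by
      gcongr
      refine (measure_mono ?_).trans hdiff
      intro x hx
      exact hx rfl
    _ ≤ ENNReal.ofReal δ * μ (π ⁻¹' (π '' U)) := by
      rw [← mul_assoc]
      gcongr
      · rw [← ENNReal.ofReal_coe_nnreal, ← ENNReal.ofReal_mul k.coe_nonneg]
        refine ENNReal.ofReal_le_ofReal ?_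
        rw [mul_div_assoc', div_le_iff₀ (by positivity)]
        nlinarith [k.coe_nonneg]
      · exact subset_preimage_image π U

/-- Constancy is tested against the averaging projection over the single block `B`. -/
theorem mulOp_indicator_eq_smul_of_mem_constantVectors (hμ : UniformlyBounded μ) {B : Set X}
    (hB : MeasurableSet B) (hBb : Bounded B) (hB0 : μ B ≠ 0) {v : Lp ℂ 2 μ}
    (hv : v ∈ constantVectors (controlledAlgebra μ).subtype) :
    mulOp (linf μ (B.indicator 1)) v = avg v B • l2ind μ B := by
  have hF : BlockFamily μ fun _ : Unit => B :=
    ⟨fun _ => hB, fun _ _ h => absurd rfl h, fun _ => hB0, fun _ => hμ.measure_ne_top hBb hB⟩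
  have hc : IsControlled (blockSet (range fun _ : Unit => B)) := by
    refine CoarseSpace.mono hBb ?_
    rintro ⟨x, y⟩ hxy
    obtain ⟨-, h1, h2⟩ := mem_blockSet_range.1 hxy
    exact ⟨h1, h2⟩
  have h1 : blockProj μ (fun _ : Unit => B) v =
      mulOp (linf μ ((⋃ _ : Unit, B).indicator 1)) v := hv _ _ (isPhi_blockElem hμ hF hc)
  have h2 := mulOp_indicator_blockProj hF () v
  rwa [h1, iUnion_const, mulOp_indicator_mulOp_indicator hB hB, inter_self] at h2

/-- A constant vector is a scalar multiple of the indicator on every finite union of cells. An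
unbounded space has infinitely many cells, so these unions have arbitrarily large measure, and
square integrability forces the scalar to be zero. -/
theorem eq_zero_of_mem_constantVectors (hconn : Connected X) (hμ : UniformlyBounded μ)
    (h : Cells μ π c) (hX : ¬ Bounded (univ : Set X)) {v : Lp ℂ 2 μ}
    (hv : v ∈ constantVectors (controlledAlgebra μ).subtype) : v = 0 := by
  classical
  have hinf : Infinite ι := by
    by_contra hfin
    rw [not_infinite_iff_finite] at hfin
    have := Fintype.ofFinite ι
    refine hX ?_
    have := h.bounded_finset hconn Finset.univ
    rwa [Finset.coe_univ, preimage_univ] at this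
  have hcell : ∀ i, mulOp (linf μ ((π ⁻¹' {i}).indicator 1)) v = 0 := by
    intro i
    have key : ∀ n : ℕ, ‖mulOp (linf μ ((π ⁻¹' {i}).indicator 1)) v‖ ^ 2 * (n * c) ≤
        ‖v‖ ^ 2 * μ.real (π ⁻¹' {i}) := by
      intro n
      obtain ⟨s₀, hs₀⟩ := Infinite.exists_subset_card_eq ι n
      set s := insert i s₀
      have hBm := h.measurableSet (s : Set ι)
      have hBb := h.bounded_finset hconn s
      have hBf := hμ.measure_ne_top hBb hBm
      have hn : n * c ≤ μ.real (π ⁻¹' (s : Set ι)) := by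
        have h1 := (h.card_le_measure s₀).trans
          (measure_mono (preimage_mono (Finset.coe_subset.2 (Finset.subset_insert i s₀))))
        have h2 := ENNReal.toReal_mono hBf h1
        rwa [hs₀, ENNReal.toReal_mul, ENNReal.toReal_ofReal h.pos.le, ENNReal.toReal_natCast] at h2
      have hsub : π ⁻¹' {i} ⊆ π ⁻¹' (s : Set ι) := preimage_mono (by simp [s])
      have h1 := mulOp_indicator_eq_smul_of_mem_constantVectors hμ hBm hBb
        (((h.measure_pos i).trans_le (measure_mono hsub)).ne') hv
      have h2 : mulOp (linf μ ((π ⁻¹' {i}).indicator 1)) v =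
          avg v (π ⁻¹' (s : Set ι)) • l2ind μ (π ⁻¹' {i}) := by
        have := congrArg (mulOp (linf μ ((π ⁻¹' {i}).indicator 1))) h1
        rwa [map_smul, mulOp_indicator_mulOp_indicator (h.measurableSet _) hBm,
          mulOp_indicator_l2ind (h.measurableSet _) hBm hBf,
          inter_eq_self_of_subset_left hsub] at this
      have h3 := norm_mulOp_indicator_le hBm v
      rw [h1, norm_smul] at h3
      have h4 : (‖avg v (π ⁻¹' (s : Set ι))‖ * ‖l2ind μ (π ⁻¹' (s : Set ι))‖) ^ 2 ≤ ‖v‖ ^ 2 := by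
        gcongr
      rw [mul_pow, norm_sq_l2ind hBm hBf] at h4
      rw [h2, norm_smul, mul_pow, norm_sq_l2ind (h.measurableSet _) (h.measure_ne_top hμ i)]
      calc ‖avg v (π ⁻¹' (s : Set ι))‖ ^ 2 * μ.real (π ⁻¹' {i}) * (n * c)
          ≤ ‖avg v (π ⁻¹' (s : Set ι))‖ ^ 2 * μ.real (π ⁻¹' {i}) * μ.real (π ⁻¹' (s : Set ι)) := by
            gcongr
        _ = ‖avg v (π ⁻¹' (s : Set ι))‖ ^ 2 * μ.real (π ⁻¹' (s : Set ι)) * μ.real (π ⁻¹' {i}) := by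
            ring
        _ ≤ _ := by gcongr
    by_contra hne
    have hpos : 0 < ‖mulOp (linf μ ((π ⁻¹' {i}).indicator 1)) v‖ ^ 2 * c :=
      mul_pos (pow_pos (norm_pos_iff.2 hne) 2) h.pos
    obtain ⟨n, hn⟩ := exists_nat_gt (‖v‖ ^ 2 * μ.real (π ⁻¹' {i}) /
      (‖mulOp (linf μ ((π ⁻¹' {i}).indicator 1)) v‖ ^ 2 * c))
    rw [div_lt_iff₀ hpos] at hn
    have := key n
    linarith
  apply Lp.ext
  have hall : ∀ᵐ x ∂μ, ∀ i, x ∈ π ⁻¹' {i} → v x = 0 := by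
    rw [ae_all_iff]
    intro i
    filter_upwards [coeFn_mulOp_linf (bddMeasurable_indicator (h.measurableSet {i})) v,
      Lp.coeFn_zero ℂ 2 μ] with x h1 h2 hx
    rw [hcell i, h2, indicator_of_mem hx] at h1
    simpa using h1.symm
  filter_upwards [hall, Lp.coeFn_zero ℂ 2 μ] with x h1 h2
  rw [h1 (π x) rfl, h2]
  rfl

end Folner

/-! ### Unbounded amenable spaces do not have property (T). -/

section Amenable

variable {X : Type u} [MeasurableSpace X] {μ : Measure X} [CoarseSpace X]

theorem not_geometricPropertyT_of_amenable [MeasurableSingletonClass X] (hconn : Connected X)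
    (hcount : CountablyCovered X) (hμ : UniformlyBounded μ) (hg : ∃ E, Gordo μ E)
    (hX : ¬ Bounded (univ : Set X)) (ham : Amenable μ) : ¬ GeometricPropertyT μ := by
  rintro ⟨E, ε, γ, hE, hε, hγ, hT⟩
  obtain ⟨ι, _, π, c, h⟩ := exists_cells hcount hμ hg
  have := h.sigmaFinite hμ
  -- With `δ = γ ^ 2 / 16` the error is at most `2 * ‖T‖ * (γ / 4) = γ / 2 * ‖T‖` for the unit
  -- vector, strictly below `γ * ‖T‖` as `T ≠ 0`.
  obtain ⟨W, ⟨x, hx⟩, hWb, ⟨J, rfl⟩, hW⟩ := exists_folner_cells hcount hμ hg ham h hE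
    (δ := γ ^ 2 / 16) (by positivity)
  have hWm := h.measurableSet J
  have hWf := hμ.measure_ne_top hWb hWm
  have hW0 : 0 < μ.real (π ⁻¹' J) := by
    refine ENNReal.toReal_pos ?_ hWf
    exact ((h.measure_pos (π x)).trans_le (measure_mono (preimage_mono
      (singleton_subset_iff.2 hx)))).ne'
  set w := l2ind μ (π ⁻¹' J) with hw
  have hwn : ‖w‖ = √(μ.real (π ⁻¹' J)) := by
    rw [hw, ← norm_sq_l2ind hWm hWf, Real.sqrt_sq (norm_nonneg _)]
  have hw0 : 0 < ‖w‖ := by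
    rw [hwn]
    exact Real.sqrt_pos.2 hW0
  obtain ⟨T, f, hT0, ⟨𝒜, h𝒜, hTs⟩, hTf, hle⟩ := hT (Lp ℂ 2 μ) (controlledAlgebra μ).subtype
    ((‖w‖⁻¹ : ℂ) • w) (by
      rw [Submodule.mem_orthogonal]
      intro v hv
      rw [eq_zero_of_mem_constantVectors hconn hμ h hX hv, inner_zero_left]) (by
      rw [norm_smul, norm_inv, Complex.norm_real, norm_norm, inv_mul_cancel₀ hw0.ne'])
  have hDle := hW 𝒜 h𝒜.subset
  have hDf : μ (splitBlocks 𝒜 (π ⁻¹' J)) ≠ ⊤ :=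
    ne_top_of_le_ne_top (ENNReal.mul_ne_top ENNReal.ofReal_ne_top hWf) hDle
  have h1 := norm_sub_mulOp_le_splitBlocks hTf (h𝒜.countable hε) h𝒜.measurableSet h𝒜.disjoint hTs
    hWm hWb hWf hDf
  have h2 : √(μ.real (splitBlocks 𝒜 (π ⁻¹' J))) ≤ γ / 4 * ‖w‖ := by
    rw [hwn, Real.sqrt_le_left (by positivity), mul_pow, Real.sq_sqrt hW0.le]
    have h3 := ENNReal.toReal_mono (ENNReal.mul_ne_top ENNReal.ofReal_ne_top hWf) hDle
    rw [ENNReal.toReal_mul, ENNReal.toReal_ofReal (by positivity)] at h3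
    refine h3.trans_eq ?_
    rw [Measure.real]
    ring
  have hTn : 0 < ‖T.1‖ := norm_pos_iff.2 fun h' => hT0 (Subtype.ext h')
  have h3 : ‖(controlledAlgebra μ).subtype (T - mulElem f) ((‖w‖⁻¹ : ℂ) • w)‖ =
      ‖w‖⁻¹ * ‖T.1 w - mulOp f w‖ := by
    rw [map_smul, norm_smul, norm_inv, Complex.norm_real, norm_norm]
    rfl
  rw [h3] at hle
  have h4 : ‖w‖⁻¹ * ‖T.1 w - mulOp f w‖ ≤ ‖w‖⁻¹ * (2 * ‖T.1‖ * (γ / 4 * ‖w‖)) := by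
    gcongr
    exact h1.trans (by gcongr)
  have h5 : ‖w‖⁻¹ * (2 * ‖T.1‖ * (γ / 4 * ‖w‖)) = γ / 2 * ‖T.1‖ := by
    field_simp
    ring
  nlinarith [mul_pos hγ hTn]

end Amenable

end CoarseSpace

theorem mainTheorem2 {X : Type u} [Nonempty X] [CoarseSpace X] [MeasurableSpace X]
    [MeasurableSingletonClass X] (μ : Measure X)
    (hconn : CoarseSpace.Connected X)
    (hcount : CoarseSpace.CountablyCovered X)
    (hμ : CoarseSpace.UniformlyBounded μ)
    (hgordo : ∃ E : Set (X × X), CoarseSpace.Gordo μ E) :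
    (CoarseSpace.Bounded (Set.univ : Set X) →
      CoarseSpace.Amenable μ ∧ CoarseSpace.GeometricPropertyT μ) ∧
    (¬ CoarseSpace.Bounded (Set.univ : Set X) →
      (CoarseSpace.GeometricPropertyT μ ↔ ¬ CoarseSpace.Amenable μ)) := by
  refine ⟨fun hX => ⟨CoarseSpace.amenable_of_bounded hX,
    CoarseSpace.geometricPropertyT_of_bounded hX hμ hgordo⟩, fun hX => ⟨fun hT ham => ?_,
    CoarseSpace.geometricPropertyT_of_not_amenable hconn hcount hμ hgordo⟩⟩
  exact CoarseSpace.not_geometricPropertyT_of_amenable hconn hcount hμ hgordo hX ham hT
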